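/- Let $\overline{\mathbb R}=\mathbb R\sqcup\{\infty\}$ be the extended real line (the one-point compactification of $\mathbb R$), and let $\varphi$ be a holomorphic function on $\mathbb C\setminus\mathbb R$. Complex Radon measures are understood to be finite (of finite total variation). A complex Radon measure $\lambda$ on $\overline{\mathbb R}$ is called a representing measure of $\varphi$ if $$\varphi(w)=\frac{\varphi(i)+\varphi(-i)}{2}+\int_{\overline{\mathbb R}}\frac{1+sw}{s-w}\,\lambda(ds)\qquad(w\in\mathbb C\setminus\mathbb R),$$ where the integrand takes the value $w$ at $s=\infty$. We say that $\varphi$ behaves simply at $s\in\mathbb R$ if $(\operatorname{Im} z)\varphi(z)$ is bounded for $z\in U\setminus\mathbb R$, where $U$ is some neighborhood of $s$ in $\mathbb C$; that it behaves simply at $\infty$ if $z\mapsto\varphi(-1/z)$ behaves simply at $0$; and that it behaves simply on $\overline{\mathbb R}$ if it behaves simply at every point of $\overline{\mathbb R}$ (equivalently, $\frac{\operatorname{Im} z}{1+|z|^2}\varphi(z)$ is bounded on $V\setminus\mathbb R$ for some neighborhood $V$ of $\overline{\mathbb R}$ in the Riemann sphere). For an open set $S\subset\mathbb R$, a complex Radon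 measure $\lambda_S$ on $S$ is called a boundary measure of $\varphi$ on $S$ if $$\lim_{y\to+0}\int_{-\infty}^{\infty}f(x)\,\frac{\varphi(x+iy)-\varphi(x-iy)}{2\pi i(1+x^2)}\,dx=\int_S f(x)\,\lambda_S(dx)\qquad\text{for all } f\in C_c^\infty(S).$$ **Theorem.** The function $\varphi$ admits a representing measure if and only if the following two conditions hold: (i) $\varphi$ behaves simply on $\overline{\mathbb R}$; (ii) there is an open set $S\subset\mathbb R$ with $\mathbb R\setminus S$ finite such that $\varphi$ admits a boundary measure $\lambda_S$ on $S$. Moreover, suppose that this is the case, let $\lambda$ be the representing measure of $\varphi$, let $S$ and $\lambda_S$ be any pair as in (ii), and put $$\varphi_S(z)=\int_S\frac{1+sz}{s-z}\,\lambda_S(ds)\quad(z\in\mathbb C\setminus\mathbb R),\qquad \Sigma=(\mathbb R\setminus S)\sqcup\{\infty\}.$$ Then $\varphi-\varphi_S$ extends holomorphically to $(\mathbb C\setminus\mathbb R)\sqcup S$, and each point of $\Sigma$ is at most a simple pole of it: there are complex numbers $\rho(\sigma)$ ($\sigma\in\Sigma$) such that $\varphi(z)-\varphi_S(z)-\frac{\rho(\sigma)}{z-\sigma}$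 extends holomorphically to a neighborhood of $z=\sigma$ for each $\sigma\in\mathbb R\setminus S$, and $\varphi(1/z)-\varphi_S(1/z)-\frac{\rho(\infty)}{z}$ extends holomorphically to a neighborhood of $z=0$. The measure $\lambda$ coincides with $\lambda_S$ on $S$, and its atoms on $\Sigma$ are $$\lambda[\sigma]=-\frac{\rho(\sigma)}{1+\sigma^2}\quad(\sigma\in\mathbb R\setminus S),\qquad \lambda[\infty]=\rho(\infty).$$ -/

import Mathlib

open MeasureTheory Filter Topology
open scoped OnePoint

namespace BoundaryMeasure

/-- The Borel σ-algebra of the extended real line `ℝ ⊔ {∞}`, which is the one-point compactification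
`OnePoint ℝ` of `ℝ`. -/
instance instMeasurableSpaceOnePointReal : MeasurableSpace (OnePoint ℝ) := borel _

instance instBorelSpaceOnePointReal : BorelSpace (OnePoint ℝ) := ⟨rfl⟩

/-- The imaginary domain `ℂ ∖ ℝ`. -/
def imaginaryDomain : Set ℂ := {z | z.im ≠ 0}

/-- The integral of a complex function against a complex measure: Mathlib's integral of a function
against a vector measure, paired by the multiplication of `ℂ`. -/
noncomputable def cintegral {X : Type*} [MeasurableSpace X] (μ : ComplexMeasure X) (f : X → ℂ) : ℂ :=
  VectorMeasure.integral μ f (ContinuousLinearMap.mul ℝ ℂ)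

/-- The kernel `(1 + s w) / (s - w)` for real `s`. -/
noncomputable def kernel (w : ℂ) (s : ℝ) : ℂ := (1 + (s : ℂ) * w) / ((s : ℂ) - w)

/-- The continuous extension of the kernel `(1 + s w) / (s - w)` to `s ∈ ℝ ⊔ {∞}`, with value `w` at
`s = ∞`. -/
noncomputable def extKernel (w : ℂ) (s : OnePoint ℝ) : ℂ := s.elim w (kernel w)

/-- `lam`, a complex (Radon) measure on the extended real line, is a representing measure of `φ`.
Complex Borel measures on the compact metrizable space `OnePoint ℝ` are automatically Radon. -/
def IsRepresentingMeasure (φ : ℂ → ℂ) (lam : ComplexMeasure (OnePoint ℝ)) : Prop :=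
  ∀ w ∈ imaginaryDomain,
    φ w = (φ Complex.I + φ (-Complex.I)) / 2 + cintegral lam (extKernel w)

/-- `φ` behaves simply at the real point `s`: `(Im z) φ(z)` is bounded for nonreal `z` in a
neighborhood of `s`. -/
def BehavesSimplyAt (φ : ℂ → ℂ) (s : ℝ) : Prop :=
  ∃ U ∈ 𝓝 (s : ℂ), ∃ C : ℝ, ∀ z ∈ U ∩ imaginaryDomain, ‖(z.im : ℂ) * φ z‖ ≤ C

/-- `φ` behaves simply on the extended real line: at each real point, and at `∞`, the latter meaning
that the inversion `z ↦ φ (-1 / z)` behaves simply at `0`. -/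
def BehavesSimply (φ : ℂ → ℂ) : Prop :=
  (∀ s : ℝ, BehavesSimplyAt φ s) ∧ BehavesSimplyAt (fun z => φ (-1 / z)) 0

/-- `lamS`, a complex (Radon) measure on `S ⊆ ℝ`, is the boundary measure of `φ` on `S`. -/
def IsBoundaryMeasure (φ : ℂ → ℂ) (S : Set ℝ) (lamS : ComplexMeasure S) : Prop :=
  ∀ f : ℝ → ℂ, ContDiff ℝ ((⊤ : ℕ∞) : WithTop ℕ∞) f → HasCompactSupport f → tsupport f ⊆ S →
    Tendsto
      (fun y : ℝ => ∫ x : ℝ, f x *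
        ((φ ((x : ℂ) + (y : ℂ) * Complex.I) - φ ((x : ℂ) - (y : ℂ) * Complex.I)) /
          (2 * (Real.pi : ℂ) * Complex.I * (1 + (x : ℂ) ^ 2))))
      (𝓝[>] 0) (𝓝 (cintegral lamS (fun s : S => f s)))

/-- The function `φ_S(z) = ∫_S (1 + s z) / (s - z) λ_S(ds)`. -/
noncomputable def transformOn (S : Set ℝ) (lamS : ComplexMeasure S) (z : ℂ) : ℂ :=
  cintegral lamS (fun s : S => kernel z s)

/-- `g` has at most a simple pole at `c`, with residue `ρ`: near `c`, off `c`, the function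
`g z - ρ / (z - c)` agrees with a function that is holomorphic near `c`. -/
def HasAtMostSimplePoleWithResidue (g : ℂ → ℂ) (c ρ : ℂ) : Prop :=
  ∃ h : ℂ → ℂ, AnalyticAt ℂ h c ∧ ∀ᶠ z in 𝓝[≠] c, g z - ρ / (z - c) = h z

end BoundaryMeasure

/-! The transform of a measure on the extended line has two visible properties. Its kernel is
bounded by `(1 + 2|w|²)/|Im w|`, which gives simple behaviour everywhere. Its jump across the line
at height `y` is the measure smeared by the Poisson kernel, so the Stieltjes inversion formula
(`tendsto_integral_extTransform`) recovers the measure on `ℝ` as a boundary measure. The atom at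
infinity contributes `O(y)` and is invisible. This settles necessity, with `S = ℝ`, and shows that a
representing measure agrees with any boundary measure on `S`.

For sufficiency, subtract the transform of `λ_S` from `φ`. The difference still behaves simply, and
its distributional jump on `S` is zero. The analytic core is `exists_extension_of_jump_eq_zero`:
such a function continues across `S`. To see this, mollify horizontally. Derivatives then fall on
the mollifier, so every derivative is still `O(1/|Im z|)`. Integrating this bound twice in the
vertical direction shows that the mollified function has a bounded derivative, hence one-sided
limits on the line. The two limits agree because the jump vanishes when tested against translates of
the mollifier, and Morera's theorem gives an extension. The mollification is then removed by
Cauchy's formula on a circle. The bound `C/|Im z|` blows up at the two real points of the circle,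
and the polynomial weight `(z - c)² - r²`, of modulus `2r|Im z|` on the circle, compensates for
this.

The same weight and the maximum principle bound the difference near each remaining point: it has at
most simple poles on `ℝ ∖ S` and linear growth at infinity. By Liouville it equals `a + bz + ∑
ρ(σ)/(z - σ)` (`exists_eq_rational_of_jump_eq_zero`). A fraction `1/(z - σ)` is, up to a constant,
the kernel of the point `σ` divided by `-(1 + σ²)`, and `z` is the kernel of `∞`. So the rational
part is the transform of finitely many atoms, which gives both the representing measure and the
formulas for its atoms. -/

namespace BoundaryMeasure

/-! ### Integration against complex measures -/

section Integral

variable {X : Type*} [MeasurableSpace X]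

instance isFiniteMeasure_variation_signedMeasure (s : SignedMeasure X) :
    IsFiniteMeasure s.variation := by
  rw [← SignedMeasure.totalVariation_eq_variation]; infer_instance

/-- The variation is dominated by the sum of those of the real and imaginary parts. Its finiteness
is what makes every bounded measurable function integrable. -/
instance isFiniteMeasure_variation_complexMeasure (μ : ComplexMeasure X) :
    IsFiniteMeasure μ.variation := by
  refine isFiniteMeasure_of_le
    ((ComplexMeasure.re μ).variation + (ComplexMeasure.im μ).variation) ?_
  refine VectorMeasure.variation_le_of_forall_enorm_le fun E hE => ?_
  have h : ‖μ E‖ₑ ≤ ‖(μ E).re‖ₑ + ‖(μ E).im‖ₑ := by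
    simp only [← ofReal_norm, ← ENNReal.ofReal_add (norm_nonneg _) (norm_nonneg _)]
    exact ENNReal.ofReal_le_ofReal (by simpa using Complex.norm_le_abs_re_add_abs_im (μ E))
  refine h.trans ?_
  rw [Measure.add_apply]
  exact add_le_add ((ComplexMeasure.re μ).enorm_measure_le_variation E)
    ((ComplexMeasure.im μ).enorm_measure_le_variation E)

theorem integrable_of_measurable_of_norm_le (μ : ComplexMeasure X) {f : X → ℂ}
    (hf : Measurable f) {C : ℝ} (hC : ∀ x, ‖f x‖ ≤ C) : μ.Integrable f :=
  Integrable.of_bound hf.aestronglyMeasurable C (Eventually.of_forall hC)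

/-- The pairing is only declared bilinear over `ℝ`, so complex homogeneity has to be checked on the
pairing itself. -/
theorem cintegral_const_mul (μ : ComplexMeasure X) (c : ℂ) (f : X → ℂ) :
    cintegral μ (fun x => c * f x) = c * cintegral μ f := by
  refine setToFun_smul (𝕜 := ℂ)
    (dominatedFinMeasAdditive_cbmApplyMeasure μ (ContinuousLinearMap.mul ℝ ℂ))
    (fun c s x => ?_) c f
  change (c * x) * μ s = c * (x * μ s)
  ring

theorem cintegral_add {μ : ComplexMeasure X} {f g : X → ℂ} (hf : μ.Integrable f)
    (hg : μ.Integrable g) :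
    cintegral μ (fun x => f x + g x) = cintegral μ f + cintegral μ g :=
  VectorMeasure.integral_fun_add hf hg

theorem cintegral_sub {μ : ComplexMeasure X} {f g : X → ℂ} (hf : μ.Integrable f)
    (hg : μ.Integrable g) :
    cintegral μ (fun x => f x - g x) = cintegral μ f - cintegral μ g :=
  VectorMeasure.integral_fun_sub hf hg

theorem norm_cintegral_le (μ : ComplexMeasure X) {f : X → ℂ} {C : ℝ} (hC : ∀ x, ‖f x‖ ≤ C) :
    ‖cintegral μ f‖ ≤ C * μ.variation.real Set.univ := by
  have h := VectorMeasure.norm_integral_le_of_norm_le_const (μ := μ)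
    (B := ContinuousLinearMap.mul ℝ ℂ) (Eventually.of_forall hC)
  simpa [cintegral] using h

theorem tendsto_cintegral_of_norm_le {ι : Type*} {l : Filter ι} [l.IsCountablyGenerated]
    (μ : ComplexMeasure X) {F : ι → X → ℂ} {f : X → ℂ} {C : ℝ}
    (hm : ∀ᶠ n in l, Measurable (F n)) (hC : ∀ᶠ n in l, ∀ x, ‖F n x‖ ≤ C)
    (hlim : ∀ x, Tendsto (fun n => F n x) l (𝓝 (f x))) :
    Tendsto (fun n => cintegral μ (F n)) l (𝓝 (cintegral μ f)) :=
  VectorMeasure.tendsto_integral_filter_of_norm_le_const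
    (hm.mono fun _ h => h.aestronglyMeasurable)
    ⟨C, hC.mono fun _ h => Eventually.of_forall h⟩ (Eventually.of_forall hlim)

theorem cintegral_map {Y : Type*} [MeasurableSpace Y] (μ : ComplexMeasure X) {e : X → Y}
    (he : MeasurableEmbedding e) (f : Y → ℂ) :
    cintegral (μ.map e) f = cintegral μ (fun x => f (e x)) :=
  he.integral_map_vectorMeasure

theorem cintegral_dirac [MeasurableSingletonClass X] (a : X) (c : ℂ) (f : X → ℂ) :
    cintegral (VectorMeasure.dirac a c) f = f a * c := by
  simp [cintegral]

theorem cintegral_add_measure {μ ν : ComplexMeasure X} {f : X → ℂ}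
    (hμ : μ.Integrable f) (hν : ν.Integrable f) :
    cintegral (μ + ν) f = cintegral μ f + cintegral ν f :=
  VectorMeasure.integral_add_vectorMeasure hμ hν

theorem cintegral_sum_measure {ι : Type*} (s : Finset ι) {μ : ι → ComplexMeasure X} {f : X → ℂ}
    (h : ∀ i ∈ s, (μ i).Integrable f) :
    cintegral (∑ i ∈ s, μ i) f = ∑ i ∈ s, cintegral (μ i) f :=
  VectorMeasure.integral_finsetSum_vectorMeasure h

theorem cintegral_indicator_one (μ : ComplexMeasure X) {A : Set X} (hA : MeasurableSet A) :
    cintegral μ (A.indicator fun _ => 1) = μ A := by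
  have := VectorMeasure.integral_indicator_const (μ := μ) (B := ContinuousLinearMap.mul ℝ ℂ)
    (1 : ℂ) hA
  simpa [cintegral] using this

end Integral

/-! ### Fubini for continuous kernels on a compact space -/

/-- The kernel is read as a curve in the Banach space `C(X, ℂ)`. A Bochner integral there commutes
with continuous functionals, which reduces Fubini to the boundedness of integration against the
measure. -/
theorem integrable_curry {X : Type*} [TopologicalSpace X] [CompactSpace X] {G : ℝ → X → ℂ}
    (hG : Continuous fun p : ℝ × X => G p.1 p.2) {K : Set ℝ} (hK : IsCompact K)
    (hGK : ∀ x ∉ K, ∀ s, G x s = 0) :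
    Integrable fun x => (ContinuousMap.curry ⟨_, hG⟩ : C(ℝ, C(X, ℂ))) x := by
  refine (ContinuousMap.continuous _).integrable_of_hasCompactSupport
    (HasCompactSupport.intro hK fun x hx => ?_)
  ext s
  exact hGK x hx s

theorem integral_curry_apply {X : Type*} [TopologicalSpace X] [CompactSpace X]
    {G : ℝ → X → ℂ}
    (hG : Continuous fun p : ℝ × X => G p.1 p.2) {K : Set ℝ} (hK : IsCompact K)
    (hGK : ∀ x ∉ K, ∀ s, G x s = 0) (s : X) :
    (∫ x, (ContinuousMap.curry ⟨_, hG⟩ : C(ℝ, C(X, ℂ))) x) s = ∫ x, G x s :=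
  ((ContinuousMap.evalCLM ℂ s).integral_comp_comm (integrable_curry hG hK hGK)).symm

theorem continuous_integral_of_compact_support {X : Type*} [TopologicalSpace X] [CompactSpace X]
    {G : ℝ → X → ℂ}
    (hG : Continuous fun p : ℝ × X => G p.1 p.2) {K : Set ℝ} (hK : IsCompact K)
    (hGK : ∀ x ∉ K, ∀ s, G x s = 0) : Continuous fun s => ∫ x, G x s := by
  simp_rw [← integral_curry_apply hG hK hGK]
  exact ContinuousMap.continuous _

section CompactSpace

variable {X : Type*} [TopologicalSpace X] [CompactSpace X] [MeasurableSpace X] [BorelSpace X]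

theorem integrable_of_continuous (μ : ComplexMeasure X) {f : X → ℂ} (hf : Continuous f) :
    μ.Integrable f :=
  integrable_of_measurable_of_norm_le μ hf.measurable
    (fun x => (ContinuousMap.mk f hf).norm_coe_le_norm x)

/-- Integration against a complex measure as a continuous linear functional. -/
noncomputable def cintegralCLM (μ : ComplexMeasure X) : C(X, ℂ) →L[ℂ] ℂ :=
  LinearMap.mkContinuous
    { toFun := fun f => cintegral μ f
      map_add' := fun f g => cintegral_add (integrable_of_continuous μ f.continuous)
        (integrable_of_continuous μ g.continuous)
      map_smul' := fun c f => cintegral_const_mul μ c f }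
    (μ.variation.real Set.univ)
    (fun f => by
      rw [mul_comm]
      exact norm_cintegral_le μ fun x => f.norm_coe_le_norm x)

theorem cintegralCLM_apply (μ : ComplexMeasure X) (f : C(X, ℂ)) :
    cintegralCLM μ f = cintegral μ f := rfl

/-- Fubini's theorem for a continuous kernel which is compactly supported in the outer variable. -/
theorem integral_cintegral (μ : ComplexMeasure X) {G : ℝ → X → ℂ}
    (hG : Continuous fun p : ℝ × X => G p.1 p.2) {K : Set ℝ} (hK : IsCompact K)
    (hGK : ∀ x ∉ K, ∀ s, G x s = 0) :
    ∫ x, cintegral μ (G x) = cintegral μ fun s => ∫ x, G x s := by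
  refine ((cintegralCLM μ).integral_comp_comm (integrable_curry hG hK hGK)).trans ?_
  rw [cintegralCLM_apply]
  congr 1
  ext s
  exact integral_curry_apply hG hK hGK s

end CompactSpace

/-! ### The kernel on the extended line -/

theorem isOpen_imaginaryDomain : IsOpen imaginaryDomain :=
  isOpen_ne_fun Complex.continuous_im continuous_const

theorem ofReal_sub_ne_zero {w : ℂ} (hw : w ∈ imaginaryDomain) (s : ℝ) : (s : ℂ) - w ≠ 0 := by
  intro h
  apply hw
  simpa using congrArg Complex.im h

theorem abs_im_le_norm_ofReal_sub (w : ℂ) (s : ℝ) : |w.im| ≤ ‖(s : ℂ) - w‖ := by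
  simpa using Complex.abs_im_le_norm ((s : ℂ) - w)

/-- This form isolates the value `w` at infinity, and the remainder decays in `s`; it serves for
size estimates. -/
theorem kernel_eq {w : ℂ} (hw : w ∈ imaginaryDomain) (s : ℝ) :
    kernel w s = w + (1 + w ^ 2) / ((s : ℂ) - w) := by
  have := ofReal_sub_ne_zero hw s
  rw [kernel]
  field_simp
  ring

/-- This form isolates the pole at `w = s`, with residue `-(1 + s²)`; it serves for jumps and for
simple fractions. -/
theorem kernel_eq' {w : ℂ} (hw : w ∈ imaginaryDomain) (s : ℝ) :
    kernel w s = -s + (1 + (s : ℂ) ^ 2) / ((s : ℂ) - w) := by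
  have := ofReal_sub_ne_zero hw s
  rw [kernel]
  field_simp
  ring

@[simp] theorem extKernel_infty (w : ℂ) : extKernel w ∞ = w := rfl

@[simp] theorem extKernel_coe (w : ℂ) (s : ℝ) : extKernel w (s : OnePoint ℝ) = kernel w s := rfl

theorem continuousAt_extKernel {w : ℂ} (hw : w ∈ imaginaryDomain) (s : OnePoint ℝ) :
    ContinuousAt (fun p : ℂ × OnePoint ℝ => extKernel p.1 p.2) (w, s) := by
  induction s using OnePoint.rec with
  | infty =>
    set T : OnePoint ℝ → ℂ := fun s => s.elim 0 (fun x : ℝ => (x : ℂ)⁻¹) with hT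
    have hTc : ContinuousAt T ∞ := by
      rw [OnePoint.continuousAt_infty', coclosedCompact_eq_cocompact,
        ← Metric.cobounded_eq_cocompact]
      have : Tendsto (fun x : ℝ => ((x⁻¹ : ℝ) : ℂ)) (Bornology.cobounded ℝ) (𝓝 ((0 : ℝ) : ℂ)) :=
        (Complex.continuous_ofReal.tendsto 0).comp tendsto_inv₀_cobounded
      simpa [hT, Function.comp_def] using this
    have hTc' : ContinuousAt (fun p : ℂ × OnePoint ℝ => T p.2) (w, ∞) :=
      ContinuousAt.comp (g := T) (f := Prod.snd) hTc continuousAt_snd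
    -- In the coordinate `T = 1/s` the kernel is `(T + w)/(1 - wT)`, which is regular at `T = 0`.
    have h1 : ContinuousAt (fun p : ℂ × OnePoint ℝ => (T p.2 + p.1) / (1 - p.1 * T p.2)) (w, ∞) := by
      refine (hTc'.add continuousAt_fst).div
        (continuousAt_const.sub (continuousAt_fst.mul hTc')) ?_
      simp [hT]
    refine h1.congr ?_
    -- The point `s = 0` has to be avoided: there the convention `0⁻¹ = 0` makes the formula in `T`
    -- false.
    have h0 : ∀ᶠ p : ℂ × OnePoint ℝ in 𝓝 (w, ∞), p.2 ≠ ((0 : ℝ) : OnePoint ℝ) :=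
      continuousAt_snd.eventually_ne (OnePoint.infty_ne_coe 0)
    filter_upwards [h0] with p hp
    obtain ⟨z, s⟩ := p
    induction s using OnePoint.rec with
    | infty => simp [hT]
    | coe s =>
      have hs : (s : ℂ) ≠ 0 := by
        intro h; apply hp; simpa using h
      simp only [hT, extKernel_coe, kernel, OnePoint.elim_some]
      rw [← mul_div_mul_left _ _ hs]
      congr 1 <;> field_simp
  | coe s =>
    have he : IsOpenEmbedding (Prod.map id ((↑) : ℝ → OnePoint ℝ) : ℂ × ℝ → ℂ × OnePoint ℝ) :=
      IsOpenEmbedding.id.prodMap OnePoint.isOpenEmbedding_coe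
    have : ContinuousAt ((fun p : ℂ × OnePoint ℝ => extKernel p.1 p.2) ∘
        (Prod.map id ((↑) : ℝ → OnePoint ℝ) : ℂ × ℝ → ℂ × OnePoint ℝ)) (w, s) := by
      change ContinuousAt (fun p : ℂ × ℝ => (1 + (p.2 : ℂ) * p.1) / ((p.2 : ℂ) - p.1)) (w, s)
      refine ContinuousAt.div (by fun_prop) (by fun_prop) (ofReal_sub_ne_zero hw s)
    exact he.continuousAt_iff.1 this

theorem continuous_extKernel {w : ℂ} (hw : w ∈ imaginaryDomain) : Continuous (extKernel w) :=
  continuous_iff_continuousAt.2 fun s =>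
    ContinuousAt.comp (x := s) (f := fun s => (w, s)) (continuousAt_extKernel hw s) (by fun_prop)

theorem norm_im_mul_extKernel_le {w : ℂ} (hw : w ∈ imaginaryDomain) (s : OnePoint ℝ) :
    |w.im| * ‖extKernel w s‖ ≤ 1 + 2 * ‖w‖ ^ 2 := by
  have h1 : |w.im| ≤ ‖w‖ := Complex.abs_im_le_norm w
  have h2 : |w.im| * ‖w‖ ≤ ‖w‖ ^ 2 := by rw [sq]; gcongr
  induction s using OnePoint.rec with
  | infty => rw [extKernel_infty]; nlinarith [sq_nonneg ‖w‖]
  | coe s =>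
    have h0 : 0 < |w.im| := abs_pos.2 hw
    have h3 : 0 < ‖(s : ℂ) - w‖ := norm_pos_iff.2 (ofReal_sub_ne_zero hw s)
    have h4 : ‖1 + w ^ 2‖ ≤ 1 + ‖w‖ ^ 2 := by
      refine (norm_add_le _ _).trans ?_; simp
    have h5 : |w.im| * (‖1 + w ^ 2‖ / ‖(s : ℂ) - w‖) ≤ ‖1 + w ^ 2‖ := by
      rw [mul_div_assoc', div_le_iff₀ h3, mul_comm]
      gcongr
      exact abs_im_le_norm_ofReal_sub w s
    rw [extKernel_coe, kernel_eq hw]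
    calc |w.im| * ‖w + (1 + w ^ 2) / ((s : ℂ) - w)‖
        ≤ |w.im| * (‖w‖ + ‖1 + w ^ 2‖ / ‖(s : ℂ) - w‖) := by
          gcongr; refine (norm_add_le _ _).trans ?_; rw [norm_div]
      _ ≤ _ := by rw [mul_add]; linarith

/-! ### Growth and holomorphy of the transform -/

/-- The transform `w ↦ ∫ (1 + s w) / (s - w) λ(ds)` of a complex measure on `ℝ ⊔ {∞}`. -/
noncomputable def extTransform (lam : ComplexMeasure (OnePoint ℝ)) (w : ℂ) : ℂ :=
  cintegral lam (extKernel w)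

theorem norm_im_mul_extTransform_le (lam : ComplexMeasure (OnePoint ℝ)) {w : ℂ}
    (hw : w ∈ imaginaryDomain) :
    |w.im| * ‖extTransform lam w‖ ≤ (1 + 2 * ‖w‖ ^ 2) * lam.variation.real Set.univ := by
  have h := norm_cintegral_le lam (f := fun s => (w.im : ℂ) * extKernel w s)
    (C := 1 + 2 * ‖w‖ ^ 2) (fun s => by
      rw [norm_mul, Complex.norm_real]; exact norm_im_mul_extKernel_le hw s)
  rwa [cintegral_const_mul, norm_mul, Complex.norm_real] at h

theorem neg_one_div_mem_imaginaryDomain {z : ℂ} (hz : z ∈ imaginaryDomain) :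
    -1 / z ∈ imaginaryDomain := by
  have hz0 : z ≠ 0 := by rintro rfl; exact hz rfl
  have : (-1 / z).im = z.im / Complex.normSq z := by
    simp [neg_div]
  change (-1 / z).im ≠ 0
  rw [this]
  exact div_ne_zero hz (by simpa using hz0)

theorem im_neg_one_div (z : ℂ) : (-1 / z).im = z.im / ‖z‖ ^ 2 := by
  rw [← Complex.normSq_eq_norm_sq]
  simp [neg_div]

/-- Since `Im(-1/z) = Im z / |z|²`, the weight `|Im w| / (1 + |w|²)` is invariant under `w ↦ -1/w`.
One global bound therefore covers the real points and infinity. -/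
theorem behavesSimply_of_norm_le {φ : ℂ → ℂ} {C : ℝ}
    (h : ∀ w ∈ imaginaryDomain, |w.im| * ‖φ w‖ ≤ C * (1 + ‖w‖ ^ 2)) : BehavesSimply φ := by
  have hC : 0 ≤ C := by
    have := h Complex.I (by simp [imaginaryDomain])
    have h2 : 0 ≤ |Complex.I.im| * ‖φ Complex.I‖ := by positivity
    simp only [Complex.norm_I] at this
    linarith
  constructor
  · intro s
    refine ⟨Metric.ball (s : ℂ) 1, Metric.ball_mem_nhds _ one_pos,
      C * (1 + (‖(s : ℂ)‖ + 1) ^ 2), fun z hz => ?_⟩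
    rw [norm_mul, Complex.norm_real]
    refine (h z hz.2).trans ?_
    gcongr
    have := hz.1
    rw [mem_ball_iff_norm] at this
    calc ‖z‖ = ‖(s : ℂ) + (z - s)‖ := by ring_nf
      _ ≤ ‖(s : ℂ)‖ + ‖z - s‖ := norm_add_le _ _
      _ ≤ _ := by gcongr
  · refine ⟨Metric.ball 0 1, by simpa using Metric.ball_mem_nhds (0 : ℂ) one_pos,
      C * 2, fun z hz => ?_⟩
    have hz0 : z ≠ 0 := by rintro rfl; exact hz.2 rfl
    have hzn : 0 < ‖z‖ := norm_pos_iff.2 hz0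
    have hz1 : ‖z‖ < 1 := by simpa using hz.1
    have := h _ (neg_one_div_mem_imaginaryDomain hz.2)
    rw [im_neg_one_div, abs_div, norm_div, norm_neg, norm_one, abs_of_nonneg (sq_nonneg ‖z‖)] at this
    rw [norm_mul, Complex.norm_real, Real.norm_eq_abs]
    have h2 : |z.im| * ‖φ (-1 / z)‖ = ‖z‖ ^ 2 * (|z.im| / ‖z‖ ^ 2 * ‖φ (-1 / z)‖) := by
      field_simp
    rw [h2]
    refine (mul_le_mul_of_nonneg_left this (by positivity)).trans ?_
    have h3 : ‖z‖ ^ 2 * (C * (1 + (1 / ‖z‖) ^ 2)) = C * (‖z‖ ^ 2 + 1) := by field_simp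
    rw [h3]
    gcongr
    nlinarith

theorem IsRepresentingMeasure.behavesSimply {φ : ℂ → ℂ} {lam : ComplexMeasure (OnePoint ℝ)}
    (h : IsRepresentingMeasure φ lam) : BehavesSimply φ := by
  set c := (φ Complex.I + φ (-Complex.I)) / 2 with hc
  refine behavesSimply_of_norm_le (C := ‖c‖ + 2 * lam.variation.real Set.univ) fun w hw => ?_
  have h1 := norm_im_mul_extTransform_le lam hw
  have h2 : |w.im| ≤ 1 + ‖w‖ ^ 2 := by
    have := Complex.abs_im_le_norm w
    nlinarith [sq_nonneg (‖w‖ - 1)]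
  have h0 : 0 ≤ lam.variation.real Set.univ := by positivity
  rw [h w hw, ← hc]
  calc |w.im| * ‖c + cintegral lam (extKernel w)‖
      ≤ |w.im| * (‖c‖ + ‖extTransform lam w‖) := by gcongr; exact norm_add_le _ _
    _ ≤ (1 + ‖w‖ ^ 2) * ‖c‖ + (1 + 2 * ‖w‖ ^ 2) * lam.variation.real Set.univ := by
      rw [mul_add]; gcongr
    _ ≤ _ := by nlinarith [sq_nonneg ‖w‖]

/-- This bounds the `w`-derivative `(1 + s²)/(s - w)²` of the kernel uniformly in `s`, as needed for
differentiation under the integral. -/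
theorem exists_one_add_sq_le {w : ℂ} (hw : w ∈ imaginaryDomain) :
    ∃ M : ℝ, ∀ s : ℝ, 1 + s ^ 2 ≤ M * ‖(s : ℂ) - w‖ ^ 2 := by
  refine ⟨2 + (1 + 2 * ‖w‖ ^ 2) / |w.im| ^ 2, fun s => ?_⟩
  have h0 : 0 < |w.im| := abs_pos.2 hw
  have h1 : |s| ≤ ‖(s : ℂ) - w‖ + ‖w‖ := by
    calc |s| = ‖((s : ℂ) - w) + w‖ := by simp
      _ ≤ _ := norm_add_le _ _
  have h2 : s ^ 2 ≤ (‖(s : ℂ) - w‖ + ‖w‖) ^ 2 := by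
    rw [← sq_abs s]; gcongr
  have h3 : |w.im| ^ 2 ≤ ‖(s : ℂ) - w‖ ^ 2 := by
    gcongr; exact abs_im_le_norm_ofReal_sub w s
  have h4 : 1 + 2 * ‖w‖ ^ 2 ≤ (1 + 2 * ‖w‖ ^ 2) / |w.im| ^ 2 * ‖(s : ℂ) - w‖ ^ 2 := by
    rw [div_mul_eq_mul_div, le_div_iff₀ (by positivity)]
    gcongr
  nlinarith [sq_nonneg (‖(s : ℂ) - w‖ - ‖w‖)]

theorem hasDerivAt_kernel {w : ℂ} (hw : w ∈ imaginaryDomain) (s : ℝ) :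
    HasDerivAt (fun z => kernel z s) ((1 + (s : ℂ) ^ 2) / ((s : ℂ) - w) ^ 2) w := by
  have h0 := ofReal_sub_ne_zero hw s
  have h1 : HasDerivAt (fun z : ℂ => 1 + (s : ℂ) * z) (s : ℂ) w := by
    simpa using ((hasDerivAt_id w).const_mul (s : ℂ)).const_add 1
  have h2 : HasDerivAt (fun z : ℂ => (s : ℂ) - z) (-1) w := by
    simpa using (hasDerivAt_id w).const_sub (s : ℂ)
  exact (h1.div h2 h0).congr_deriv (by congr 1; ring)

theorem differentiableOn_extTransform (lam : ComplexMeasure (OnePoint ℝ)) :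
    DifferentiableOn ℂ (extTransform lam) imaginaryDomain := by
  intro w hw
  obtain ⟨M, hM⟩ := exists_one_add_sq_le hw
  have him : 0 < |w.im| := abs_pos.2 hw
  have hM0 : 0 ≤ M := by
    have := hM 0
    by_contra hneg
    nlinarith [sq_nonneg ‖((0 : ℝ) : ℂ) - w‖]
  have hev : ∀ᶠ z in 𝓝[≠] w, z ∈ imaginaryDomain :=
    nhdsWithin_le_nhds (isOpen_imaginaryDomain.mem_nhds hw)
  have key : HasDerivAt (extTransform lam)
      (cintegral lam fun s => s.elim 1 fun s : ℝ => (1 + (s : ℂ) ^ 2) / ((s : ℂ) - w) ^ 2) w := by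
    rw [hasDerivAt_iff_tendsto_slope]
    have h1 : ∀ z ∈ imaginaryDomain, slope (extTransform lam) w z =
        cintegral lam fun s => (z - w)⁻¹ * (extKernel z s - extKernel w s) := by
      intro z hz
      rw [cintegral_const_mul, cintegral_sub (integrable_of_continuous lam (continuous_extKernel hz))
        (integrable_of_continuous lam (continuous_extKernel hw))]
      rfl
    refine Tendsto.congr' (hev.mono fun z hz => (h1 z hz).symm) ?_
    -- For real `s` the difference quotient is `(1 + s²)/((s - w)(s - z))`. It is at most `2M` once
    -- `|z - w| < |Im w|/2`, since then `|s - z| ≥ |s - w|/2`. At infinity the quotient is `1`.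
    refine tendsto_cintegral_of_norm_le lam (C := 1 + 2 * M)
      (hev.mono fun z hz => (((continuous_extKernel hz).sub
        (continuous_extKernel hw)).const_mul _).measurable) ?_ ?_
    · have hball : ∀ᶠ z in 𝓝[≠] w, z ∈ Metric.ball w (|w.im| / 2) :=
        nhdsWithin_le_nhds (Metric.ball_mem_nhds w (by positivity))
      filter_upwards [hev, hball, self_mem_nhdsWithin] with z hz hzb hzw s
      have hzw0 : z - w ≠ 0 := sub_ne_zero.2 hzw
      induction s using OnePoint.rec with
      | infty =>
        simp only [extKernel_infty]
        rw [inv_mul_cancel₀ hzw0, norm_one]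
        linarith
      | coe s =>
        have hsw := ofReal_sub_ne_zero hw s
        have hsz := ofReal_sub_ne_zero hz s
        have e : (z - w)⁻¹ * (extKernel z s - extKernel w s) =
            ((1 + s ^ 2 : ℝ) : ℂ) / (((s : ℂ) - w) * ((s : ℂ) - z)) := by
          rw [extKernel_coe, extKernel_coe, kernel, kernel]
          push_cast
          field_simp
          ring
        have hnz : ‖(s : ℂ) - w‖ / 2 ≤ ‖(s : ℂ) - z‖ := by
          have h3 := norm_sub_norm_le ((s : ℂ) - w) (z - w)
          have h4 : ‖z - w‖ < |w.im| / 2 := by simpa [dist_eq_norm] using hzb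
          have h5 := abs_im_le_norm_ofReal_sub w s
          have h6 : (s : ℂ) - w - (z - w) = s - z := by ring
          rw [h6] at h3
          linarith
        have hp : 0 < ‖(s : ℂ) - w‖ := norm_pos_iff.2 hsw
        rw [e, norm_div, norm_mul, Complex.norm_real, Real.norm_of_nonneg (by positivity)]
        rw [div_le_iff₀ (mul_pos hp (norm_pos_iff.2 hsz))]
        calc 1 + s ^ 2 ≤ M * ‖(s : ℂ) - w‖ ^ 2 := hM s
          _ = 2 * M * (‖(s : ℂ) - w‖ * (‖(s : ℂ) - w‖ / 2)) := by ring
          _ ≤ (1 + 2 * M) * (‖(s : ℂ) - w‖ * ‖(s : ℂ) - z‖) := by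
            gcongr; linarith
    · intro s
      induction s using OnePoint.rec with
      | infty =>
        simp only [extKernel_infty, OnePoint.elim_infty]
        refine tendsto_const_nhds.congr' ?_
        filter_upwards [self_mem_nhdsWithin] with z hz
        rw [inv_mul_cancel₀ (sub_ne_zero.2 hz)]
      | coe s => exact hasDerivAt_iff_tendsto_slope.1 (hasDerivAt_kernel hw s)
  exact key.differentiableAt.differentiableWithinAt

/-! ### Poisson integrals and Stieltjes inversion -/

/-- The substitution `x = s + yt` trades the moving Poisson kernel for the fixed integrable density
`1/(1 + t²)`, which then serves as the dominating function. -/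
theorem integral_mul_poisson {F : ℝ → ℂ} (s : ℝ) {y : ℝ} (hy : 0 < y) :
    ∫ x, F x * ((y / ((x - s) ^ 2 + y ^ 2) : ℝ) : ℂ) =
      ∫ t, F (s + y * t) * (((1 + t ^ 2)⁻¹ : ℝ) : ℂ) := by
  set g : ℝ → ℂ := fun x => F x * ((y / ((x - s) ^ 2 + y ^ 2) : ℝ) : ℂ) with hg
  have h1 : ∫ t, g (s + y * t) = |y⁻¹| • ∫ x, g x := by
    rw [Measure.integral_comp_mul_left (fun u => g (s + u)) y, integral_add_left_eq_self]
  have h2 : ∫ x, g x = ∫ t, y • g (s + y * t) := by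
    rw [integral_smul, h1, abs_of_pos (inv_pos.2 hy), smul_smul, mul_inv_cancel₀ hy.ne', one_smul]
  rw [h2]
  congr 1
  ext t
  have e : y * (y / ((s + y * t - s) ^ 2 + y ^ 2)) = (1 + t ^ 2)⁻¹ := by
    field_simp
    ring
  rw [← e, hg]
  simp only [Complex.real_smul]
  push_cast
  ring

theorem norm_mul_inv_one_add_sq_le {F : ℝ → ℂ} {B : ℝ} (hB : ∀ x, ‖F x‖ ≤ B) (u t : ℝ) :
    ‖F u * (((1 + t ^ 2)⁻¹ : ℝ) : ℂ)‖ ≤ B * (1 + t ^ 2)⁻¹ := by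
  rw [norm_mul, Complex.norm_real, Real.norm_of_nonneg (by positivity)]
  gcongr
  exact hB u

theorem norm_integral_mul_poisson_le {F : ℝ → ℂ} {B : ℝ} (hB : ∀ x, ‖F x‖ ≤ B) (s : ℝ) {y : ℝ}
    (hy : 0 < y) : ‖∫ x, F x * ((y / ((x - s) ^ 2 + y ^ 2) : ℝ) : ℂ)‖ ≤ B * Real.pi := by
  rw [integral_mul_poisson s hy]
  refine (norm_integral_le_of_norm_le (integrable_inv_one_add_sq.const_mul B)
    (Eventually.of_forall fun t => norm_mul_inv_one_add_sq_le hB _ t)).trans ?_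
  rw [integral_const_mul, integral_univ_inv_one_add_sq]

theorem tendsto_integral_mul_poisson {F : ℝ → ℂ} (hF : Continuous F) {B : ℝ}
    (hB : ∀ x, ‖F x‖ ≤ B) (s : ℝ) :
    Tendsto (fun y : ℝ => ∫ x, F x * ((y / ((x - s) ^ 2 + y ^ 2) : ℝ) : ℂ)) (𝓝[>] 0)
      (𝓝 (F s * Real.pi)) := by
  have h1 : Tendsto (fun y : ℝ => ∫ t, F (s + y * t) * (((1 + t ^ 2)⁻¹ : ℝ) : ℂ)) (𝓝[>] 0)
      (𝓝 (∫ t : ℝ, F s * (((1 + t ^ 2)⁻¹ : ℝ) : ℂ))) := by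
    refine tendsto_integral_filter_of_dominated_convergence (fun t => B * (1 + t ^ 2)⁻¹)
      (Eventually.of_forall fun y => ?_) (Eventually.of_forall fun y =>
        Eventually.of_forall fun t => norm_mul_inv_one_add_sq_le hB _ t)
      (integrable_inv_one_add_sq.const_mul B) (Eventually.of_forall fun t => ?_)
    · refine Continuous.aestronglyMeasurable ?_
      refine (hF.comp (by fun_prop)).mul (Complex.continuous_ofReal.comp ?_)
      exact Continuous.inv₀ (by fun_prop) fun t => by positivity
    · refine Tendsto.mul_const _ ?_
      have : Continuous fun y : ℝ => F (s + y * t) := by fun_prop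
      have h := this.tendsto 0
      simp only [zero_mul, add_zero] at h
      exact h.mono_left nhdsWithin_le_nhds
  have h2 : ∫ t : ℝ, F s * (((1 + t ^ 2)⁻¹ : ℝ) : ℂ) = F s * Real.pi := by
    rw [integral_const_mul, integral_complex_ofReal, integral_univ_inv_one_add_sq]
  rw [h2] at h1
  refine h1.congr' ?_
  filter_upwards [self_mem_nhdsWithin] with y hy
  exact (integral_mul_poisson s hy).symm

theorem add_mul_I_mem {y : ℝ} (hy : y ≠ 0) (x : ℝ) :
    (x : ℂ) + (y : ℂ) * Complex.I ∈ imaginaryDomain := by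
  simpa [imaginaryDomain] using hy

theorem sub_mul_I_mem {y : ℝ} (hy : y ≠ 0) (x : ℝ) :
    (x : ℂ) - (y : ℂ) * Complex.I ∈ imaginaryDomain := by
  simpa [imaginaryDomain] using hy

theorem kernel_sub_kernel (x s : ℝ) {y : ℝ} (hy : 0 < y) :
    kernel ((x : ℂ) + (y : ℂ) * Complex.I) s - kernel ((x : ℂ) - (y : ℂ) * Complex.I) s =
      2 * Complex.I * ((1 + s ^ 2 : ℝ) : ℂ) * ((y / ((x - s) ^ 2 + y ^ 2) : ℝ) : ℂ) := by
  have h1 := ofReal_sub_ne_zero (add_mul_I_mem hy.ne' x) s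
  have h2 := ofReal_sub_ne_zero (sub_mul_I_mem hy.ne' x) s
  have h3 : ((s : ℂ) - (x + y * Complex.I)) * ((s : ℂ) - (x - y * Complex.I)) =
      (((x - s) ^ 2 + y ^ 2 : ℝ) : ℂ) := by
    push_cast
    linear_combination (-(y : ℂ) ^ 2) * Complex.I_sq
  have h4 : (((x - s) ^ 2 + y ^ 2 : ℝ) : ℂ) ≠ 0 := by rw [← h3]; exact mul_ne_zero h1 h2
  rw [kernel_eq' (add_mul_I_mem hy.ne' x), kernel_eq' (sub_mul_I_mem hy.ne' x), Complex.ofReal_div,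
    ← h3]
  push_cast
  field_simp
  ring

/-- Stieltjes inversion. After Fubini, the inner integral at a real `s` is `(1 + s²)/π` times the
Poisson integral of `f(x)/(1 + x²)`, which tends to `f s`; at infinity it is `O(y)`. Dominated
convergence in `s` finishes. -/
theorem tendsto_integral_extTransform (lam : ComplexMeasure (OnePoint ℝ)) {f : ℝ → ℂ}
    (hf : Continuous f) (hfc : HasCompactSupport f) :
    Tendsto (fun y : ℝ => ∫ x : ℝ, f x *
      ((extTransform lam ((x : ℂ) + (y : ℂ) * Complex.I) -
        extTransform lam ((x : ℂ) - (y : ℂ) * Complex.I)) /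
          (2 * (Real.pi : ℂ) * Complex.I * (1 + (x : ℂ) ^ 2))))
      (𝓝[>] 0) (𝓝 (cintegral lam fun s => s.elim 0 f)) := by
  have hx2 : ∀ x : ℝ, (1 + (x : ℂ) ^ 2) ≠ 0 := fun x => by
    have : (1 + x ^ 2 : ℝ) ≠ 0 := by positivity
    exact_mod_cast this
  have hpi : (Real.pi : ℂ) ≠ 0 := by exact_mod_cast Real.pi_ne_zero
  set F : ℝ → ℂ := fun x => f x / (1 + (x : ℂ) ^ 2) with hFdef
  have hF : Continuous F := hf.div (by fun_prop) hx2
  have hF0 : ∀ x ∉ tsupport f, F x = 0 := fun x hx => by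
    simp [hFdef, image_eq_zero_of_notMem_tsupport hx]
  have hFc : HasCompactSupport F := HasCompactSupport.intro hfc hF0
  obtain ⟨B, hB⟩ := hFc.exists_bound_of_continuous hF
  have hB0 : 0 ≤ B := (norm_nonneg _).trans (hB 0)
  have hFi : Integrable F := hF.integrable_of_hasCompactSupport hFc
  obtain ⟨R, hR1, hR⟩ : ∃ R : ℝ, 1 ≤ R ∧ ∀ x, F x ≠ 0 → |x| ≤ R := by
    obtain ⟨R, hR⟩ := hfc.isBounded.exists_norm_le
    refine ⟨max R 1, le_max_right _ _, fun x hx => ?_⟩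
    refine (hR x ?_).trans (le_max_left _ _)
    by_contra h
    exact hx (hF0 x h)
  set G : ℝ → ℝ → OnePoint ℝ → ℂ := fun y x s => F x * (2 * (Real.pi : ℂ) * Complex.I)⁻¹ *
    (extKernel ((x : ℂ) + (y : ℂ) * Complex.I) s - extKernel ((x : ℂ) - (y : ℂ) * Complex.I) s)
    with hG
  have hGc : ∀ y : ℝ, 0 < y → Continuous fun p : ℝ × OnePoint ℝ => G y p.1 p.2 := by
    intro y hy
    have h1 : Continuous fun p : ℝ × OnePoint ℝ =>
        extKernel ((p.1 : ℂ) + (y : ℂ) * Complex.I) p.2 := by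
      refine continuous_iff_continuousAt.2 fun p => ?_
      exact ContinuousAt.comp (x := p)
        (f := fun p : ℝ × OnePoint ℝ => ((p.1 : ℂ) + (y : ℂ) * Complex.I, p.2))
        (continuousAt_extKernel (add_mul_I_mem hy.ne' p.1) p.2) (by fun_prop)
    have h2 : Continuous fun p : ℝ × OnePoint ℝ =>
        extKernel ((p.1 : ℂ) - (y : ℂ) * Complex.I) p.2 := by
      refine continuous_iff_continuousAt.2 fun p => ?_
      exact ContinuousAt.comp (x := p)
        (f := fun p : ℝ × OnePoint ℝ => ((p.1 : ℂ) - (y : ℂ) * Complex.I, p.2))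
        (continuousAt_extKernel (sub_mul_I_mem hy.ne' p.1) p.2) (by fun_prop)
    exact ((hF.comp continuous_fst).mul continuous_const).mul (h1.sub h2)
  have hG0 : ∀ y : ℝ, ∀ x ∉ tsupport f, ∀ s, G y x s = 0 := fun y x hx s => by
    simp only [hG, hF0 x hx, zero_mul]
  have hGreal : ∀ y : ℝ, 0 < y → ∀ s : ℝ, ∫ x, G y x s =
      ((1 + s ^ 2 : ℝ) : ℂ) / Real.pi * ∫ x, F x * ((y / ((x - s) ^ 2 + y ^ 2) : ℝ) : ℂ) := by
    intro y hy s
    rw [← integral_const_mul]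
    congr 1
    ext x
    simp only [hG, extKernel_coe]
    rw [kernel_sub_kernel x s hy]
    field_simp
  have hGinf : ∀ y : ℝ, ∫ x, G y x ∞ = (y : ℂ) / Real.pi * ∫ x, F x := by
    intro y
    rw [← integral_const_mul]
    congr 1
    ext x
    simp only [hG, extKernel_infty]
    field_simp
    ring
  have hmain : ∀ᶠ y : ℝ in 𝓝[>] 0, cintegral lam (fun s => ∫ x, G y x s) =
      ∫ x : ℝ, f x * ((extTransform lam ((x : ℂ) + (y : ℂ) * Complex.I) -
        extTransform lam ((x : ℂ) - (y : ℂ) * Complex.I)) /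
          (2 * (Real.pi : ℂ) * Complex.I * (1 + (x : ℂ) ^ 2))) := by
    filter_upwards [self_mem_nhdsWithin] with y hy
    rw [← integral_cintegral lam (hGc y hy) hfc (hG0 y)]
    congr 1
    ext x
    rw [cintegral_const_mul, cintegral_sub
      (integrable_of_continuous lam (continuous_extKernel (add_mul_I_mem (ne_of_gt hy) x)))
      (integrable_of_continuous lam (continuous_extKernel (sub_mul_I_mem (ne_of_gt hy) x)))]
    have := hx2 x
    simp only [hFdef, extTransform]
    field_simp
  refine Tendsto.congr' hmain ?_
  have hI : 0 ≤ ∫ x, ‖F x‖ := integral_nonneg fun x => norm_nonneg _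
  have hpi3 := Real.pi_gt_three
  have hle1 : ∀ᶠ y : ℝ in 𝓝[>] 0, y < 1 := nhdsWithin_le_nhds (Iio_mem_nhds one_pos)
  refine tendsto_cintegral_of_norm_le lam (C := (1 + 4 * R ^ 2) * B + 8 * ∫ x, ‖F x‖) ?_ ?_ ?_
  · filter_upwards [self_mem_nhdsWithin] with y hy
    exact (continuous_integral_of_compact_support (hGc y hy) hfc (hG0 y)).measurable
  · filter_upwards [self_mem_nhdsWithin, hle1] with y hy hy1 s
    have hy0 : 0 < y := hy
    induction s using OnePoint.rec with
    | infty =>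
      rw [hGinf, norm_mul, norm_div, Complex.norm_real, Complex.norm_real,
        Real.norm_of_nonneg hy0.le, Real.norm_of_nonneg Real.pi_pos.le]
      have h1 : y / Real.pi ≤ 1 := by rw [div_le_one Real.pi_pos]; linarith
      have h2 := norm_integral_le_integral_norm F (μ := volume)
      have h3 : y / Real.pi * ‖∫ x, F x‖ ≤ 1 * ∫ x, ‖F x‖ := by gcongr
      have h4 : 0 ≤ (1 + 4 * R ^ 2) * B := by positivity
      linarith
    | coe s =>
      rw [hGreal y hy, norm_mul, norm_div, Complex.norm_real, Complex.norm_real,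
        Real.norm_of_nonneg Real.pi_pos.le, Real.norm_of_nonneg (by positivity : 0 ≤ 1 + s ^ 2)]
      -- The factor `1 + s²` is unbounded in `s`, so total mass of the Poisson kernel suffices only
      -- for `|s| ≤ 2R`. Beyond that, `|x - s| ≥ |s|/2` on the support, and the kernel is at most
      -- `4/s²` for `y < 1`. The choice `R ≥ 1` gives `4(1 + s²)/s² ≤ 8`.
      rcases le_or_gt |s| (2 * R) with hs | hs
      · have h1 := norm_integral_mul_poisson_le hB s hy
        have h2 : s ^ 2 ≤ 4 * R ^ 2 := by
          rw [← sq_abs s]; nlinarith [abs_nonneg s]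
        calc (1 + s ^ 2) / Real.pi * ‖∫ x, F x * ((y / ((x - s) ^ 2 + y ^ 2) : ℝ) : ℂ)‖
            ≤ (1 + 4 * R ^ 2) / Real.pi * (B * Real.pi) := by gcongr
          _ = (1 + 4 * R ^ 2) * B := by field_simp
          _ ≤ _ := by linarith
      · have hs2 : 4 < s ^ 2 := by rw [← sq_abs s]; nlinarith
        have h1 : ‖∫ x, F x * ((y / ((x - s) ^ 2 + y ^ 2) : ℝ) : ℂ)‖ ≤
            ∫ x, ‖F x‖ * (4 / s ^ 2) := by
          refine norm_integral_le_of_norm_le (hFi.norm.mul_const _)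
            (Eventually.of_forall fun x => ?_)
          rw [norm_mul]
          by_cases hx : F x = 0
          · simp [hx]
          gcongr
          rw [Complex.norm_real, Real.norm_of_nonneg (by positivity),
            div_le_div_iff₀ (by positivity) (by positivity)]
          have h3 : |s| / 2 ≤ |x - s| := by
            have := abs_sub_abs_le_abs_sub s x
            rw [abs_sub_comm] at this
            linarith [hR x hx]
          have h4 : s ^ 2 / 4 ≤ (x - s) ^ 2 := by
            rw [← sq_abs s, ← sq_abs (x - s)]; nlinarith [abs_nonneg s]
          nlinarith
        rw [integral_mul_const] at h1
        calc (1 + s ^ 2) / Real.pi * ‖∫ x, F x * ((y / ((x - s) ^ 2 + y ^ 2) : ℝ) : ℂ)‖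
            ≤ (1 + s ^ 2) / 1 * ((∫ x, ‖F x‖) * (4 / s ^ 2)) := by
              gcongr; linarith
          _ = (∫ x, ‖F x‖) * (4 * (1 + s ^ 2) / s ^ 2) := by field_simp
          _ ≤ (∫ x, ‖F x‖) * 8 := by
              gcongr
              rw [div_le_iff₀ (by positivity)]
              linarith
          _ ≤ _ := by
              have : 0 ≤ (1 + 4 * R ^ 2) * B := by positivity
              linarith
  · intro s
    induction s using OnePoint.rec with
    | infty =>
      simp_rw [hGinf]
      have h1 : Continuous fun y : ℝ => (y : ℂ) / Real.pi * ∫ x, F x := by fun_prop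
      have h2 := h1.tendsto 0
      simp only [Complex.ofReal_zero, zero_div, zero_mul] at h2
      exact h2.mono_left nhdsWithin_le_nhds
    | coe s =>
      have h1 := (tendsto_integral_mul_poisson hF hB s).const_mul (((1 + s ^ 2 : ℝ) : ℂ) / Real.pi)
      have h2 : ((1 + s ^ 2 : ℝ) : ℂ) / Real.pi * (F s * Real.pi) = f s := by
        have := hx2 s
        simp only [hFdef]
        push_cast
        field_simp
      rw [h2] at h1
      refine h1.congr' ?_
      filter_upwards [self_mem_nhdsWithin] with y hy
      exact (hGreal y hy s).symm

/-! ### A measure is determined on an open set by its test integrals -/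

/-- The indicator of an open set of reals is a pointwise limit of test functions supported in it,
with values in `[0, 1]`. -/
theorem exists_contDiff_tendsto_indicator {W : Set ℝ} (hW : IsOpen W) :
    ∃ f : ℕ → ℝ → ℝ, (∀ n, ContDiff ℝ ((⊤ : ℕ∞) : WithTop ℕ∞) (f n)) ∧
      (∀ n, HasCompactSupport (f n)) ∧ (∀ n, tsupport (f n) ⊆ W) ∧ (∀ n x, 0 ≤ f n x) ∧
      (∀ n x, f n x ≤ 1) ∧ ∀ x, Tendsto (fun n => f n x) atTop (𝓝 (W.indicator 1 x)) := by
  obtain ⟨g, hgs, hgc, hg0⟩ := hW.exists_contDiff_support_eq (n := ⊤)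
  have hgnn : ∀ x, 0 ≤ g x := fun x => (hg0 (Set.mem_range_self x)).1
  let b : ℕ → ContDiffBump (0 : ℝ) := fun n => ⟨n + 1, n + 2, by positivity, by linarith⟩
  have hcl : ∀ n : ℕ, tsupport (fun x => Real.smoothTransition (n * g x - 1)) ⊆ W := by
    intro n
    have hclosed : IsClosed {x | 1 ≤ n * g x} :=
      isClosed_le continuous_const (continuous_const.mul hgc.continuous)
    refine (closure_minimal ?_ hclosed).trans fun x hx => ?_
    · intro x hx
      by_contra h
      exact hx (Real.smoothTransition.zero_of_nonpos (by simp only [Set.mem_ofPred_eq] at h; linarith))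
    · rw [← hgs, Function.mem_support]
      rintro h
      simp only [Set.mem_ofPred_eq, h, mul_zero] at hx
      linarith
  -- The first factor vanishes where `n g ≤ 1` and equals `1` where `n g ≥ 2`, so its support stays
  -- inside `W`. The bump, equal to `1` on `[-(n+1), n+1]`, supplies compactness.
  refine ⟨fun n x => Real.smoothTransition (n * g x - 1) * b n x, fun n => ?_, fun n => ?_,
    fun n => ?_, fun n x => ?_, fun n x => ?_, fun x => ?_⟩
  · exact (Real.smoothTransition.contDiff.comp
      ((contDiff_const.mul hgc).sub contDiff_const)).mul (b n).contDiff
  · exact (b n).hasCompactSupport.mul_left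
  · exact (tsupport_mul_subset_left).trans (hcl n)
  · exact mul_nonneg (Real.smoothTransition.nonneg _) (b n).nonneg
  · exact mul_le_one₀ (Real.smoothTransition.le_one _) (b n).nonneg (b n).le_one
  · by_cases hx : x ∈ W
    · have hgx : 0 < g x := lt_of_le_of_ne (hgnn x) (Ne.symm (by rw [← hgs] at hx; exact hx))
      rw [Set.indicator_of_mem hx, Pi.one_apply]
      refine tendsto_const_nhds.congr' ?_
      obtain ⟨N, hN⟩ := exists_nat_gt (2 / g x)
      obtain ⟨M, hM⟩ := exists_nat_gt |x|
      filter_upwards [eventually_ge_atTop N, eventually_ge_atTop M] with n hn hm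
      have h1 : (2 : ℝ) ≤ n * g x := by
        rw [div_lt_iff₀ hgx] at hN
        have : (N : ℝ) ≤ n := by exact_mod_cast hn
        nlinarith
      have h2 : |x| ≤ n + 1 := by
        have : (M : ℝ) ≤ n := by exact_mod_cast hm
        linarith
      rw [Real.smoothTransition.one_of_one_le (by linarith), (b n).one_of_mem_closedBall, one_mul]
      simpa using h2
    · have hgx : g x = 0 := by
        by_contra h
        exact hx (hgs ▸ h)
      rw [Set.indicator_of_notMem hx]
      refine tendsto_const_nhds.congr fun n => ?_
      simp only [hgx]
      rw [mul_zero, zero_sub, Real.smoothTransition.zero_of_nonpos (by norm_num), zero_mul]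

theorem measurableEmbedding_coe : MeasurableEmbedding ((↑) : ℝ → OnePoint ℝ) :=
  OnePoint.isOpenEmbedding_coe.measurableEmbedding

theorem measurable_elim {E : Type*} [Zero E] [MeasurableSpace E] {f : ℝ → E} (hf : Measurable f) :
    Measurable fun s : OnePoint ℝ => s.elim 0 f := by
  have h : (fun s : OnePoint ℝ => s.elim 0 f) =
      Function.extend ((↑) : ℝ → OnePoint ℝ) f 0 := by
    ext s
    induction s using OnePoint.rec with
    | infty =>
      rw [Function.extend_apply' _ _ _ (by rintro ⟨a, ha⟩; exact OnePoint.coe_ne_infty a ha)]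
      rfl
    | coe s => rw [OnePoint.coe_injective.extend_apply]; rfl
  rw [h]
  exact measurableEmbedding_coe.measurable_extend hf measurable_zero

theorem tendsto_cintegral_elim (μ : ComplexMeasure (OnePoint ℝ)) {W : Set ℝ} (hW : IsOpen W)
    {f : ℕ → ℝ → ℝ} (hc : ∀ n, Continuous (f n)) (h0 : ∀ n x, 0 ≤ f n x) (h1 : ∀ n x, f n x ≤ 1)
    (hlim : ∀ x, Tendsto (fun n => f n x) atTop (𝓝 (W.indicator 1 x))) :
    Tendsto (fun n => cintegral μ fun s => s.elim 0 fun x => (f n x : ℂ)) atTop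
      (𝓝 (μ ((fun s : ℝ => (s : OnePoint ℝ)) '' W))) := by
  rw [← cintegral_indicator_one μ (measurableEmbedding_coe.measurableSet_image.2 hW.measurableSet)]
  refine tendsto_cintegral_of_norm_le μ (C := 1) (Eventually.of_forall fun n =>
    measurable_elim (Complex.continuous_ofReal.comp (hc n)).measurable) (Eventually.of_forall fun n s => ?_) ?_
  · induction s using OnePoint.rec with
    | infty => simp
    | coe s =>
      simp only [OnePoint.elim_some, Complex.norm_real]
      rw [Real.norm_of_nonneg (h0 n s)]
      exact h1 n s
  · intro s
    induction s using OnePoint.rec with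
    | infty => simp
    | coe s =>
      simp only [OnePoint.elim_some]
      have h2 := (Complex.continuous_ofReal.tendsto _).comp (hlim s)
      convert h2 using 1
      congr 1
      by_cases hs : s ∈ W
      · rw [Set.indicator_of_mem hs, Set.indicator_of_mem (Set.mem_image_of_mem _ hs)]; simp
      · rw [Set.indicator_of_notMem hs, Set.indicator_of_notMem]
        · simp
        · rintro ⟨t, ht, hts⟩
          exact hs (OnePoint.coe_injective hts ▸ ht)

/-- Two complex measures on `ℝ ⊔ {∞}` which integrate all test functions on an open set `S` of
reals alike coincide on `S`. -/
theorem eq_on_of_cintegral_eq {μ ν : ComplexMeasure (OnePoint ℝ)} {S : Set ℝ} (hS : IsOpen S)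
    (h : ∀ f : ℝ → ℂ, ContDiff ℝ ((⊤ : ℕ∞) : WithTop ℕ∞) f → HasCompactSupport f →
      tsupport f ⊆ S → cintegral μ (fun s => s.elim 0 f) = cintegral ν (fun s => s.elim 0 f))
    {A : Set ℝ} (hA : MeasurableSet A) (hAS : A ⊆ S) :
    μ ((fun s : ℝ => (s : OnePoint ℝ)) '' A) = ν ((fun s : ℝ => (s : OnePoint ℝ)) '' A) := by
  have hopen : ∀ W : Set ℝ, IsOpen W → W ⊆ S →
      μ ((fun s : ℝ => (s : OnePoint ℝ)) '' W) = ν ((fun s : ℝ => (s : OnePoint ℝ)) '' W) := by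
    intro W hW hWS
    obtain ⟨f, hf, hfc, hfs, hf0, hf1, hlim⟩ := exists_contDiff_tendsto_indicator hW
    have h1 := tendsto_cintegral_elim μ hW (fun n => (hf n).continuous) hf0 hf1 hlim
    have h2 := tendsto_cintegral_elim ν hW (fun n => (hf n).continuous) hf0 hf1 hlim
    refine tendsto_nhds_unique (h1.congr fun n => ?_) h2
    refine h _ (Complex.ofRealCLM.contDiff.comp (hf n)) ((hfc n).comp_left Complex.ofReal_zero) ?_
    exact (tsupport_comp_subset Complex.ofReal_zero _).trans ((hfs n).trans hWS)
  have hSm : MeasurableSet ((fun s : ℝ => (s : OnePoint ℝ)) '' S) :=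
    measurableEmbedding_coe.measurableSet_image.2 hS.measurableSet
  -- Restricting both measures to `S` lets the π-system of all open sets of the extended line be
  -- used: each meets `S` in an open subset of `ℝ`.
  have key : μ.restrict ((fun s : ℝ => (s : OnePoint ℝ)) '' S) =
      ν.restrict ((fun s : ℝ => (s : OnePoint ℝ)) '' S) := by
    refine VectorMeasure.ext_of_generateFrom {s | IsOpen s} (fun V hV => ?_) rfl
      isPiSystem_isOpen ?_
    · have hVm : MeasurableSet V := IsOpen.measurableSet hV
      rw [VectorMeasure.restrict_apply _ hSm hVm, VectorMeasure.restrict_apply _ hSm hVm]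
      have : V ∩ (fun s : ℝ => (s : OnePoint ℝ)) '' S =
          (fun s : ℝ => (s : OnePoint ℝ)) '' (S ∩ (fun s : ℝ => (s : OnePoint ℝ)) ⁻¹' V) := by
        rw [Set.image_inter_preimage, Set.inter_comm]
      rw [this]
      exact hopen _ (hS.inter (hV.preimage OnePoint.continuous_coe)) Set.inter_subset_left
    · rw [VectorMeasure.restrict_apply_univ, VectorMeasure.restrict_apply_univ]
      exact hopen S hS subset_rfl
  have hAm := measurableEmbedding_coe.measurableSet_image.2 hA
  have hsub := Set.image_mono (f := fun s : ℝ => (s : OnePoint ℝ)) hAS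
  rw [← VectorMeasure.restrict_eq_self μ hSm hAm hsub, key,
    VectorMeasure.restrict_eq_self ν hSm hAm hsub]

/-! ### Painlevé's theorem on the real line -/

open Complex in
/-- A continuous function which is holomorphic off the real line is holomorphic. -/
theorem differentiableOn_of_continuousOn_of_inter_imaginaryDomain {U : Set ℂ} (hU : IsOpen U)
    {f : ℂ → ℂ} (hc : ContinuousOn f U) (hd : DifferentiableOn ℂ f (U ∩ imaginaryDomain)) :
    DifferentiableOn ℂ f U := by
  -- If the open rectangle misses `ℝ`, Cauchy's theorem applies even when an edge lies on `ℝ`,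
  -- because it requires only continuity up to the boundary.
  have half : ∀ z w : ℂ, Rectangle z w ⊆ U → (0 : ℝ) ∉ Set.Ioo (min z.im w.im) (max z.im w.im) →
      (((∫ x : ℝ in z.re..w.re, f (x + z.im * I)) - ∫ x : ℝ in z.re..w.re, f (x + w.im * I)) +
        I • ∫ y : ℝ in z.im..w.im, f (w.re + y * I)) -
          I • ∫ y : ℝ in z.im..w.im, f (z.re + y * I) = 0 := by
    intro z w hzw h0
    refine integral_boundary_rect_eq_zero_of_continuousOn_of_differentiableOn f z w (hc.mono hzw)
      (hd.mono fun p hp => ⟨hzw ⟨Set.Ioo_subset_Icc_self hp.1, Set.Ioo_subset_Icc_self hp.2⟩, ?_⟩)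
    intro h
    exact h0 (h ▸ hp.2)
  refine ((isConservativeOn_and_continuousOn_iff_isDifferentiableOn hU).1 ⟨fun z w hzw => ?_, hc⟩)
  rw [eq_neg_iff_add_eq_zero, wedgeIntegral_add_wedgeIntegral_eq]
  by_cases h0 : (0 : ℝ) ∈ Set.Ioo (min z.im w.im) (max z.im w.im)
  swap; · exact half z w hzw h0
  have h0' : (0 : ℝ) ∈ Set.uIcc z.im w.im := Set.Ioo_subset_Icc_self h0
  have hs1 : Set.uIcc z.im 0 ⊆ Set.uIcc z.im w.im := Set.uIcc_subset_uIcc_left h0'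
  have hs2 : Set.uIcc 0 w.im ⊆ Set.uIcc z.im w.im := Set.uIcc_subset_uIcc_right h0'
  -- A rectangle crossing `ℝ` is cut along `ℝ`. The two integrals over the common real edge cancel
  -- when the identities are added.
  have e1 := half z ⟨w.re, 0⟩ (fun p hp => hzw ⟨hp.1, hs1 hp.2⟩) (by
    rcases le_total z.im 0 with h | h
    · simp [h]
    · simp [h])
  have e2 := half ⟨z.re, 0⟩ w (fun p hp => hzw ⟨hp.1, hs2 hp.2⟩) (by
    rcases le_total w.im 0 with h | h
    · simp [h]
    · simp [h])
  have hint : ∀ a ∈ Set.uIcc z.re w.re, ∀ s t : ℝ, Set.uIcc s t ⊆ Set.uIcc z.im w.im →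
      IntervalIntegrable (fun y : ℝ => f (a + y * I)) volume s t := by
    intro a ha s t hst
    refine ContinuousOn.intervalIntegrable (hc.comp (by fun_prop) fun y hy => hzw ⟨?_, ?_⟩)
    · simpa using ha
    · simpa using hst hy
  simp only at e1 e2
  rw [← intervalIntegral.integral_add_adjacent_intervals
      (hint w.re Set.right_mem_uIcc z.im 0 hs1) (hint w.re Set.right_mem_uIcc 0 w.im hs2),
    ← intervalIntegral.integral_add_adjacent_intervals
      (hint z.re Set.left_mem_uIcc z.im 0 hs1) (hint z.re Set.left_mem_uIcc 0 w.im hs2)]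
  simp only [smul_eq_mul] at e1 e2 ⊢
  linear_combination e1 + e2

/-! ### Integrating singular derivative bounds -/

/-- A bound for the derivative of a function on `(0, h]` integrates to a bound for the function. -/
theorem norm_sub_le_of_deriv_le {u u' : ℝ → ℂ} {B B' : ℝ → ℝ} {h : ℝ}
    (hu : ∀ y ∈ Set.Ioc 0 h, HasDerivAt u (u' y) y)
    (hB : ∀ y ∈ Set.Ioc 0 h, HasDerivAt B (-B' y) y)
    (hle : ∀ y ∈ Set.Ioc 0 h, ‖u' y‖ ≤ B' y) {y : ℝ} (hy : y ∈ Set.Ioc 0 h) :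
    ‖u y - u h‖ ≤ B y - B h := by
  have hmem : ∀ t ∈ Set.Icc 0 (h - y), h - t ∈ Set.Ioc 0 h := fun t ht =>
    ⟨by linarith [ht.2, hy.1], by linarith [ht.1]⟩
  have d1 : ∀ t ∈ Set.Icc 0 (h - y), HasDerivAt (fun t => u (h - t) - u h) (-u' (h - t)) t :=
    fun t ht => ((hu _ (hmem t ht)).comp_const_sub h t).sub_const _
  have d2 : ∀ t ∈ Set.Icc 0 (h - y), HasDerivAt (fun t => B (h - t) - B h) (B' (h - t)) t :=
    fun t ht => by simpa using ((hB _ (hmem t ht)).comp_const_sub h t).sub_const (B h)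
  -- The mean value inequality runs forward from the left endpoint, whereas here the known value is
  -- at `h`; hence the reversed variable `h - t`.
  have key := image_norm_le_of_norm_deriv_right_le_deriv_boundary' (a := 0) (b := h - y)
    (f := fun t => u (h - t) - u h) (f' := fun t => -u' (h - t)) (B := fun t => B (h - t) - B h)
    (B' := fun t => B' (h - t))
    (fun t ht => (d1 t ht).continuousAt.continuousWithinAt)
    (fun t ht => (d1 t (Set.Ico_subset_Icc_self ht)).hasDerivWithinAt) (by simp)
    (fun t ht => (d2 t ht).continuousAt.continuousWithinAt)
    (fun t ht => (d2 t (Set.Ico_subset_Icc_self ht)).hasDerivWithinAt)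
    (fun t ht => by rw [norm_neg]; exact hle _ (hmem t (Set.Ico_subset_Icc_self ht)))
    (x := h - y) ⟨by linarith [hy.2], le_rfl⟩
  simpa using key

/-- The primitive of `1/y` is a logarithm. Majorizing `1/y` by `√h / (y√y)` replaces it by the power
`1/√y`, which is weaker but still integrable at `0`. -/
theorem norm_le_of_deriv_le_div {u u' : ℝ → ℂ} {A h : ℝ}
    (hu : ∀ y ∈ Set.Ioc 0 h, HasDerivAt u (u' y) y) (hle : ∀ y ∈ Set.Ioc 0 h, ‖u' y‖ ≤ A / y)
    {y : ℝ} (hy : y ∈ Set.Ioc 0 h) : ‖u y‖ ≤ (‖u h‖ * √h + 2 * A * √h) / √y := by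
  have hh : 0 < h := hy.1.trans_le hy.2
  have hA : 0 ≤ A := by
    have := (norm_nonneg _).trans (hle h ⟨hh, le_rfl⟩)
    rwa [le_div_iff₀ hh, zero_mul] at this
  have hB : ∀ y ∈ Set.Ioc 0 h, HasDerivAt (fun y => 2 * A * √h / √y) (-(A * √h / (y * √y))) y := by
    intro y hy
    have h1 := ((Real.hasDerivAt_sqrt hy.1.ne').inv (Real.sqrt_pos.2 hy.1).ne').const_mul (2 * A * √h)
    refine h1.congr_deriv ?_
    have h2 := Real.sq_sqrt hy.1.le
    have h3 := (Real.sqrt_pos.2 hy.1).ne'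
    have h4 := hy.1.ne'
    rw [h2]
    field_simp
  have key := norm_sub_le_of_deriv_le hu hB (fun y hy => (hle y hy).trans (by
    have h3 := Real.sqrt_pos.2 hy.1
    rw [div_le_div_iff₀ hy.1 (mul_pos hy.1 h3)]
    have : √y ≤ √h := Real.sqrt_le_sqrt hy.2
    have h4 : A * y * √y ≤ A * y * √h := by
      have := mul_nonneg hA hy.1.le
      gcongr
    linarith)) hy
  have h1 : ‖u y‖ ≤ ‖u y - u h‖ + ‖u h‖ := by
    simpa using norm_add_le (u y - u h) (u h)
  have h3 := Real.sqrt_pos.2 hy.1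
  have h5 : ‖u h‖ ≤ ‖u h‖ * √h / √y := by
    rw [le_div_iff₀ h3]
    exact mul_le_mul_of_nonneg_left (Real.sqrt_le_sqrt hy.2) (norm_nonneg _)
  have h6 : 0 ≤ 2 * A * √h / √h := by positivity
  rw [add_div]
  linarith

theorem norm_le_of_deriv_le_div_sqrt {u u' : ℝ → ℂ} {A h : ℝ}
    (hu : ∀ y ∈ Set.Ioc 0 h, HasDerivAt u (u' y) y) (hle : ∀ y ∈ Set.Ioc 0 h, ‖u' y‖ ≤ A / √y)
    {y : ℝ} (hy : y ∈ Set.Ioc 0 h) : ‖u y‖ ≤ ‖u h‖ + 2 * A * √h := by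
  have hh : 0 < h := hy.1.trans_le hy.2
  have hA : 0 ≤ A := by
    have := (norm_nonneg _).trans (hle h ⟨hh, le_rfl⟩)
    rwa [le_div_iff₀ (Real.sqrt_pos.2 hh), zero_mul] at this
  have hB : ∀ y ∈ Set.Ioc 0 h, HasDerivAt (fun y => -(2 * A * √y)) (-(A / √y)) y := by
    intro y hy
    refine ((Real.hasDerivAt_sqrt hy.1.ne').const_mul (2 * A)).neg.congr_deriv ?_
    have h3 := (Real.sqrt_pos.2 hy.1).ne'
    field_simp
  have key := norm_sub_le_of_deriv_le hu hB hle hy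
  have h1 : ‖u y‖ ≤ ‖u y - u h‖ + ‖u h‖ := by
    simpa using norm_add_le (u y - u h) (u h)
  have h6 : 0 ≤ 2 * A * √y := by positivity
  linarith

/-! ### Horizontal mollification -/

/-- The horizontal mollification `z ↦ ∫ η(t) ψ(z - t) dt`. -/
noncomputable def hconv (η : ℝ → ℂ) (ψ : ℂ → ℂ) (z : ℂ) : ℂ := ∫ t : ℝ, η t * ψ (z - t)

theorem sub_ofReal_mem_imaginaryDomain {z : ℂ} (hz : z ∈ imaginaryDomain) (t : ℝ) :
    z - t ∈ imaginaryDomain := by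
  simpa [imaginaryDomain] using hz

theorem continuous_mul_comp_sub {η : ℝ → ℂ} (hη : Continuous η) {ψ : ℂ → ℂ}
    (hψ : ContinuousOn ψ imaginaryDomain) {z : ℂ} (hz : z ∈ imaginaryDomain) :
    Continuous fun t : ℝ => η t * ψ (z - t) :=
  hη.mul (hψ.comp_continuous (by fun_prop) fun t => sub_ofReal_mem_imaginaryDomain hz t)

theorem integrable_mul_comp_sub {η : ℝ → ℂ} (hη : Continuous η) (hηc : HasCompactSupport η)
    {ψ : ℂ → ℂ} (hψ : ContinuousOn ψ imaginaryDomain) {z : ℂ} (hz : z ∈ imaginaryDomain) :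
    Integrable fun t : ℝ => η t * ψ (z - t) :=
  (continuous_mul_comp_sub hη hψ hz).integrable_of_hasCompactSupport hηc.mul_right

/-- Differentiation under the integral puts the derivative on `ψ`; integration by parts moves it to
`η`. So differentiating does not worsen the growth at the real line. -/
theorem hasDerivAt_hconv {η : ℝ → ℂ} (hη : ContDiff ℝ 1 η) (hηc : HasCompactSupport η)
    {ψ : ℂ → ℂ} (hψ : DifferentiableOn ℂ ψ imaginaryDomain) {z : ℂ} (hz : z ∈ imaginaryDomain) :
    HasDerivAt (hconv η ψ) (hconv (deriv η) ψ z) z := by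
  have hψ' := (hψ.deriv isOpen_imaginaryDomain).continuousOn
  have hder : ∀ w ∈ imaginaryDomain, HasDerivAt ψ (deriv ψ w) w := fun w hw =>
    (hψ.differentiableAt (isOpen_imaginaryDomain.mem_nhds hw)).hasDerivAt
  obtain ⟨ε, hε, hball⟩ := Metric.nhds_basis_closedBall.mem_iff.1
    (isOpen_imaginaryDomain.mem_nhds hz)
  obtain ⟨M, hM⟩ : ∃ M, ∀ p ∈ Metric.closedBall z ε ×ˢ tsupport η,
      ‖deriv ψ (p.1 - (p.2 : ℂ))‖ ≤ M := by
    refine ((isCompact_closedBall z ε).prod hηc).exists_bound_of_continuousOn ?_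
    exact hψ'.comp (by fun_prop) fun p hp => sub_ofReal_mem_imaginaryDomain (hball hp.1) _
  have step := (hasDerivAt_integral_of_dominated_loc_of_deriv_le (μ := volume)
    (F := fun w t => η t * ψ (w - (t : ℝ))) (F' := fun w t => η t * deriv ψ (w - (t : ℝ)))
    (bound := fun t => ‖η t‖ * M) (Metric.closedBall_mem_nhds z hε)
    (Eventually.mono (isOpen_imaginaryDomain.mem_nhds hz) fun w hw =>
      (continuous_mul_comp_sub hη.continuous hψ.continuousOn hw).aestronglyMeasurable)
    (integrable_mul_comp_sub hη.continuous hηc hψ.continuousOn hz)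
    (continuous_mul_comp_sub hη.continuous hψ' hz).aestronglyMeasurable
    (Eventually.of_forall fun t w hw => by
      rw [norm_mul]
      by_cases ht : t ∈ tsupport η
      · gcongr
        exact hM (w, t) ⟨hw, ht⟩
      · simp [image_eq_zero_of_notMem_tsupport ht])
    ((hη.continuous.norm.mul continuous_const).integrable_of_hasCompactSupport
      hηc.norm.mul_right)
    (Eventually.of_forall fun t w hw => by
      have h1 : HasDerivAt (fun w : ℂ => w - (t : ℂ)) 1 w := (hasDerivAt_id w).sub_const _
      have h2 := (hder _ (sub_ofReal_mem_imaginaryDomain (hball hw) t)).comp w h1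
      simpa using h2.const_mul (η t))).2
  have hparts : ∫ t : ℝ, (deriv η t * ψ (z - t) - η t * deriv ψ (z - t)) = 0 := by
    have i1 := integrable_mul_comp_sub (hη.continuous_deriv le_rfl) hηc.deriv hψ.continuousOn hz
    have i2 := integrable_mul_comp_sub hη.continuous hηc hψ' hz
    refine integral_eq_zero_of_hasDerivAt_of_integrable (f := fun t : ℝ => η t * ψ (z - t))
      (fun t => ?_) (i1.sub i2) (integrable_mul_comp_sub hη.continuous hηc hψ.continuousOn hz)
    have h1 : HasDerivAt (fun t : ℝ => z - (t : ℂ)) (-1) t := by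
      simpa using (Complex.ofRealCLM.hasDerivAt (x := t)).const_sub z
    have h2 := (hder _ (sub_ofReal_mem_imaginaryDomain hz t)).comp t h1
    have h3 := ((hη.differentiable one_ne_zero) t).hasDerivAt.mul h2
    refine h3.congr_deriv ?_
    simp only [Function.comp_apply]
    ring
  rw [integral_sub (integrable_mul_comp_sub (hη.continuous_deriv le_rfl) hηc.deriv
    hψ.continuousOn hz) (integrable_mul_comp_sub hη.continuous hηc hψ' hz), sub_eq_zero] at hparts
  rw [hconv, hparts]
  exact step

/-- A horizontal average only involves points with the same imaginary part, so the bound on `(Im z)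
ψ(z)` survives with the `L¹` norm of `η` as a factor. -/
theorem norm_im_mul_hconv_le {ψ : ℂ → ℂ} {x₀ δ C : ℝ} (hδ : 0 < δ)
    (hC : ∀ z ∈ imaginaryDomain, z ∈ Metric.ball (x₀ : ℂ) (4 * δ) → |z.im| * ‖ψ z‖ ≤ C)
    {η : ℝ → ℂ} (hη : Continuous η) (hηc : HasCompactSupport η)
    (hηδ : ∀ t, η t ≠ 0 → |t| ≤ δ) {z : ℂ} (hz : z ∈ imaginaryDomain)
    (hre : |z.re - x₀| ≤ 2 * δ) (him : |z.im| ≤ 2 * δ) :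
    |z.im| * ‖hconv η ψ z‖ ≤ C * ∫ t, ‖η t‖ := by
  have h1 : (z.im : ℂ) * hconv η ψ z = ∫ t : ℝ, (z.im : ℂ) * (η t * ψ (z - t)) := by
    rw [integral_const_mul, hconv]
  have h2 : ‖(z.im : ℂ) * hconv η ψ z‖ ≤ ∫ t : ℝ, C * ‖η t‖ := by
    rw [h1]
    refine norm_integral_le_of_norm_le
      ((hη.norm.integrable_of_hasCompactSupport hηc.norm).const_mul C)
      (Eventually.of_forall fun t => ?_)
    by_cases ht : η t = 0
    · simp [ht]
    -- Real displacement at most `2δ + δ` and imaginary part at most `2δ` give distance at most `√13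
    -- δ < 4δ`.
    have hmem : z - t ∈ Metric.ball (x₀ : ℂ) (4 * δ) := by
      rw [mem_ball_iff_norm]
      have h3 : |z.re - t - x₀| ≤ 3 * δ := by
        have h4 := hηδ t ht
        rw [abs_le] at *
        constructor <;> linarith
      have h5 := sq_le_sq' (abs_le.1 h3).1 (abs_le.1 h3).2
      have h6 := sq_le_sq' (abs_le.1 him).1 (abs_le.1 him).2
      refine lt_of_pow_lt_pow_left₀ 2 (by positivity) ?_
      rw [← Complex.normSq_eq_norm_sq, Complex.normSq_apply]
      simp only [Complex.sub_re, Complex.sub_im, Complex.ofReal_re, Complex.ofReal_im, sub_zero]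
      nlinarith [mul_pos hδ hδ]
    have h7 := hC _ (sub_ofReal_mem_imaginaryDomain hz t) hmem
    simp only [Complex.sub_im, Complex.ofReal_im, sub_zero] at h7
    rw [norm_mul, norm_mul, Complex.norm_real, Real.norm_eq_abs]
    calc |z.im| * (‖η t‖ * ‖ψ (z - t)‖) = (|z.im| * ‖ψ (z - t)‖) * ‖η t‖ := by ring
      _ ≤ C * ‖η t‖ := by gcongr
  rwa [integral_const_mul, norm_mul, Complex.norm_real, Real.norm_eq_abs] at h2

theorem deriv_eq_zero_of_support {η : ℝ → ℂ} {δ : ℝ} (hηδ : ∀ t, η t ≠ 0 → |t| ≤ δ) (t : ℝ)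
    (ht : deriv η t ≠ 0) : |t| ≤ δ := by
  by_contra h
  push Not at h
  apply ht
  have : η =ᶠ[𝓝 t] fun _ => 0 := by
    filter_upwards [(isOpen_lt continuous_const continuous_abs).mem_nhds h] with u hu
    by_contra h2
    exact absurd (hηδ u h2) (not_le.2 hu)
  rw [this.deriv_eq, deriv_const]

/-- If `(Im z) ψ(z)` is bounded near a real point, the horizontal mollifications of `ψ` are
bounded near this point. -/
theorem exists_norm_hconv_le {ψ : ℂ → ℂ} (hψ : DifferentiableOn ℂ ψ imaginaryDomain)
    {x₀ δ C : ℝ} (hδ : 0 < δ)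
    (hC : ∀ z ∈ imaginaryDomain, z ∈ Metric.ball (x₀ : ℂ) (4 * δ) → |z.im| * ‖ψ z‖ ≤ C)
    {η : ℝ → ℂ} (hη : ContDiff ℝ 2 η) (hηc : HasCompactSupport η)
    (hηδ : ∀ t, η t ≠ 0 → |t| ≤ δ) :
    ∃ M, ∀ z ∈ imaginaryDomain, |z.re - x₀| ≤ 2 * δ → |z.im| ≤ 2 * δ → ‖hconv η ψ z‖ ≤ M := by
  have hη1 : ContDiff ℝ 1 (deriv η) := by
    have : ContDiff ℝ (1 + 1) η := by norm_num; exact hη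
    exact (contDiff_succ_iff_deriv.1 this).2.2
  have hη2 : Continuous (deriv (deriv η)) := hη1.continuous_deriv le_rfl
  have hδ1 := deriv_eq_zero_of_support hηδ
  have hδ2 := deriv_eq_zero_of_support hδ1
  set C0 := C * ∫ t, ‖η t‖ with hC0
  set C1 := C * ∫ t, ‖deriv η t‖ with hC1
  set C2 := C * ∫ t, ‖deriv (deriv η) t‖ with hC2
  set h := 2 * δ with hh
  have hhpos : 0 < h := by positivity
  -- Descend from `h` to the line twice: `η''` gives `O(1/y)`, hence `η'` gives `O(1/√y)`, hence `η`
  -- gives `O(1)`. The terms `C0 / h` and `C1 / h` bound the starting values at height `h`.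
  refine ⟨C0 / h + 2 * (C1 / h * √h + 2 * C2 * √h) * √h, fun z hz hre him => ?_⟩
  -- The sign `σ` selects the half-plane, so that one vertical path `L` treats both.
  set σ : ℝ := ((SignType.sign z.im : SignType) : ℝ) with hσ
  have hσ1 : |σ| = 1 := by
    rcases lt_trichotomy z.im 0 with h0 | h0 | h0
    · simp [hσ, sign_neg h0]
    · exact absurd h0 hz
    · simp [hσ, sign_pos h0]
  have hσ0 : σ ≠ 0 := by
    intro h0
    rw [h0] at hσ1
    simp at hσ1
  have hσz : σ * |z.im| = z.im := sign_mul_abs z.im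
  let L : ℝ → ℂ := fun y => (z.re : ℂ) + ((σ * y : ℝ) : ℂ) * Complex.I
  have hLre : ∀ y, (L y).re = z.re := fun y => by simp [L]
  have hLim : ∀ y, (L y).im = σ * y := fun y => by simp [L]
  have hLabs : ∀ y ∈ Set.Ioc 0 h, |(L y).im| = y := fun y hy => by
    rw [hLim, abs_mul, hσ1, one_mul, abs_of_pos hy.1]
  have hLmem : ∀ y ∈ Set.Ioc 0 h, L y ∈ imaginaryDomain := fun y hy => by
    change (L y).im ≠ 0
    rw [hLim]
    exact mul_ne_zero hσ0 hy.1.ne'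
  have hLz : L |z.im| = z := by
    simp only [L, hσz]
    exact Complex.re_add_im z
  have hLd : ∀ y, HasDerivAt L ((σ : ℂ) * Complex.I) y := fun y => by
    have h1 : HasDerivAt (fun y : ℝ => ((σ * y : ℝ) : ℂ)) (σ : ℂ) y := by
      simpa using ((hasDerivAt_id y).const_mul σ).ofReal_comp
    exact (h1.mul_const Complex.I).const_add _
  have hder : ∀ {ζ : ℝ → ℂ}, ContDiff ℝ 1 ζ → HasCompactSupport ζ → ∀ y ∈ Set.Ioc 0 h,
      HasDerivAt (fun y => hconv ζ ψ (L y)) (hconv (deriv ζ) ψ (L y) * ((σ : ℂ) * Complex.I)) y :=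
    fun hζ hζc y hy => (hasDerivAt_hconv hζ hζc hψ (hLmem y hy)).comp y (hLd y)
  have hnorm : ∀ v : ℂ, ‖v * ((σ : ℂ) * Complex.I)‖ = ‖v‖ := fun v => by
    rw [norm_mul, norm_mul, Complex.norm_I, Complex.norm_real, Real.norm_eq_abs, hσ1]
    simp
  have hbd : ∀ {ζ : ℝ → ℂ}, Continuous ζ → HasCompactSupport ζ → (∀ t, ζ t ≠ 0 → |t| ≤ δ) →
      ∀ y ∈ Set.Ioc 0 h, ‖hconv ζ ψ (L y)‖ ≤ (C * ∫ t, ‖ζ t‖) / y := fun hζ hζc hζδ y hy => by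
    have h1 := norm_im_mul_hconv_le hδ hC hζ hζc hζδ (hLmem y hy) (by rw [hLre]; exact hre)
      (by rw [hLabs y hy]; exact hy.2)
    rw [hLabs y hy] at h1
    rw [le_div_iff₀ hy.1, mul_comm]
    exact h1
  have hmem : h ∈ Set.Ioc 0 h := ⟨hhpos, le_rfl⟩
  have b1 : ∀ y ∈ Set.Ioc 0 h, ‖hconv (deriv η) ψ (L y)‖ ≤
      (C1 / h * √h + 2 * C2 * √h) / √y := fun y hy => by
    refine (norm_le_of_deriv_le_div (hder hη1 hηc.deriv) (A := C2)
      (fun y hy => by rw [hnorm]; exact hbd hη2 hηc.deriv.deriv hδ2 y hy) hy).trans ?_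
    gcongr
    exact hbd hη1.continuous hηc.deriv hδ1 h hmem
  have b0 := norm_le_of_deriv_le_div_sqrt (hder (hη.of_le (by norm_num)) hηc)
    (fun y hy => by rw [hnorm]; exact b1 y hy) (y := |z.im|) ⟨abs_pos.2 hz, him⟩
  simp only [hLz] at b0
  refine b0.trans ?_
  gcongr
  exact hbd hη.continuous hηc hηδ h hmem

/-! ### Extension of mollified functions across the line -/

theorem tendsto_of_lipschitzOnWith {D : Set ℂ} {g : ℂ → ℂ} {K : NNReal}
    (hg : LipschitzOnWith K g D) (x : ℂ) : ∃ l, Tendsto g (𝓝[D] x) (𝓝 l) := by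
  obtain ⟨g', hg', heq⟩ := hg.extend_finite_dimension
  refine ⟨g' x, ?_⟩
  have := (hg'.continuous.tendsto x).mono_left (nhdsWithin_le_nhds (s := D))
  exact this.congr' (heq.symm.eventuallyEq_of_mem self_mem_nhdsWithin)

theorem dense_imaginaryDomain : Dense imaginaryDomain := by
  intro z
  rw [Metric.mem_closure_iff]
  intro ε hε
  by_cases hz : z ∈ imaginaryDomain
  · exact ⟨z, hz, by simpa using hε⟩
  · have hz0 : z.im = 0 := by simpa [imaginaryDomain] using hz
    refine ⟨z + ((ε / 2 : ℝ) : ℂ) * Complex.I, ?_, ?_⟩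
    · simp [imaginaryDomain, hz0, hε.ne']
    · rw [dist_eq_norm]
      simp [abs_of_pos hε]
      linarith

/-- A holomorphic function off the real line with bounded derivative on both sides of a disk
centred at a real point, and equal boundary values along vertical lines, extends holomorphically
to the disk. -/
theorem differentiableOn_extendFrom_of_bounded_deriv {g : ℂ → ℂ}
    (hg : DifferentiableOn ℂ g imaginaryDomain) {c : ℂ} {r M : ℝ}
    (hM : ∀ z ∈ Metric.ball c r ∩ imaginaryDomain, ‖deriv g z‖ ≤ M)
    (hjump : ∀ x : ℝ, (x : ℂ) ∈ Metric.ball c r → Tendsto (fun y : ℝ =>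
      g ((x : ℂ) + (y : ℂ) * Complex.I) - g ((x : ℂ) - (y : ℂ) * Complex.I)) (𝓝[>] 0) (𝓝 0)) :
    DifferentiableOn ℂ (extendFrom imaginaryDomain g) (Metric.ball c r) := by
  have heq : ∀ z ∈ imaginaryDomain, extendFrom imaginaryDomain g z = g z :=
    extendFrom_extends hg.continuousOn
  have hdiff : ∀ z ∈ imaginaryDomain, DifferentiableAt ℂ g z := fun z hz =>
    hg.differentiableAt (isOpen_imaginaryDomain.mem_nhds hz)
  refine differentiableOn_of_continuousOn_of_inter_imaginaryDomain Metric.isOpen_ball ?_ ?_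
  swap
  · exact (hg.congr heq).mono Set.inter_subset_right
  have hM' : ∀ z ∈ Metric.ball c r ∩ imaginaryDomain, ‖deriv g z‖₊ ≤ M.toNNReal := fun z hz => by
    rw [← NNReal.coe_le_coe]
    exact (hM z hz).trans (Real.le_coe_toNNReal M)
  set Dp := Metric.ball c r ∩ {z : ℂ | 0 < z.im} with hDp
  set Dm := Metric.ball c r ∩ {z : ℂ | z.im < 0} with hDm
  -- The two half-disks are convex, so a bounded derivative gives a Lipschitz bound on each and
  -- therefore limits at every real point.
  have hp : LipschitzOnWith M.toNNReal g Dp :=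
    Convex.lipschitzOnWith_of_nnnorm_deriv_le (fun z hz => hdiff z (ne_of_gt hz.2))
      (fun z hz => hM' z ⟨hz.1, ne_of_gt hz.2⟩)
      ((convex_ball c r).inter (convex_halfSpace_im_gt 0))
  have hm : LipschitzOnWith M.toNNReal g Dm :=
    Convex.lipschitzOnWith_of_nnnorm_deriv_le (fun z hz => hdiff z (ne_of_lt hz.2))
      (fun z hz => hM' z ⟨hz.1, ne_of_lt hz.2⟩)
      ((convex_ball c r).inter (convex_halfSpace_im_lt 0))
  refine continuousOn_extendFrom (fun z _ => dense_imaginaryDomain z) fun z hz => ?_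
  by_cases hzi : z ∈ imaginaryDomain
  · exact ⟨g z, hg.continuousOn z hzi⟩
  have hz0 : z.im = 0 := by simpa [imaginaryDomain] using hzi
  obtain ⟨lp, hlp⟩ := tendsto_of_lipschitzOnWith hp z
  obtain ⟨lm, hlm⟩ := tendsto_of_lipschitzOnWith hm z
  have hzx : ((z.re : ℝ) : ℂ) = z := Complex.ext (by simp) (by simp [hz0])
  have hball : Metric.ball c r ∈ 𝓝 z := Metric.isOpen_ball.mem_nhds hz
  have hup : Tendsto (fun y : ℝ => (z.re : ℂ) + (y : ℂ) * Complex.I) (𝓝[>] 0) (𝓝[Dp] z) := by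
    have h1 : Tendsto (fun y : ℝ => (z.re : ℂ) + (y : ℂ) * Complex.I) (𝓝[>] 0) (𝓝 z) := by
      have h2 : Continuous fun y : ℝ => (z.re : ℂ) + (y : ℂ) * Complex.I := by fun_prop
      have h3 := h2.tendsto 0
      have h4 : (z.re : ℂ) + ((0 : ℝ) : ℂ) * Complex.I = z := by simp [hzx]
      rw [h4] at h3
      exact h3.mono_left nhdsWithin_le_nhds
    refine tendsto_nhdsWithin_iff.2 ⟨h1, ?_⟩
    filter_upwards [h1 hball, self_mem_nhdsWithin] with y hy hy0
    exact ⟨hy, by simpa using hy0⟩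
  have hdown : Tendsto (fun y : ℝ => (z.re : ℂ) - (y : ℂ) * Complex.I) (𝓝[>] 0) (𝓝[Dm] z) := by
    have h1 : Tendsto (fun y : ℝ => (z.re : ℂ) - (y : ℂ) * Complex.I) (𝓝[>] 0) (𝓝 z) := by
      have h2 : Continuous fun y : ℝ => (z.re : ℂ) - (y : ℂ) * Complex.I := by fun_prop
      have h3 := h2.tendsto 0
      have h4 : (z.re : ℂ) - ((0 : ℝ) : ℂ) * Complex.I = z := by simp [hzx]
      rw [h4] at h3
      exact h3.mono_left nhdsWithin_le_nhds
    refine tendsto_nhdsWithin_iff.2 ⟨h1, ?_⟩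
    filter_upwards [h1 hball, self_mem_nhdsWithin] with y hy hy0
    exact ⟨hy, by simpa using hy0⟩
  have hl : lp = lm := by
    have h1 := (hlp.comp hup).sub (hlm.comp hdown)
    exact sub_eq_zero.1 (tendsto_nhds_unique h1 (hjump z.re (by rwa [hzx])))
  refine ⟨lp, ?_⟩
  have hset : imaginaryDomain ∩ Metric.ball c r = Dp ∪ Dm := by
    ext w
    simp only [hDp, hDm, imaginaryDomain, Set.mem_inter_iff, Set.mem_union, Set.mem_ofPred_eq,
      ne_iff_lt_or_gt]
    tauto
  rw [← nhdsWithin_inter_of_mem (nhdsWithin_le_nhds hball), Set.inter_comm,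
    hset, nhdsWithin_union]
  exact hlp.sup (hl ▸ hlm)

/-- The pointwise jump of the mollification is the jump of `ψ` tested against the reflected
translate `u ↦ η (x - u)`. A vanishing distributional jump thus becomes a pointwise one. -/
theorem hconv_sub_hconv {ψ : ℂ → ℂ} (hψ : ContinuousOn ψ imaginaryDomain) {η : ℝ → ℂ}
    (hη : Continuous η) (hηc : HasCompactSupport η) (x : ℝ) {y : ℝ} (hy : y ≠ 0) :
    hconv η ψ ((x : ℂ) + (y : ℂ) * Complex.I) - hconv η ψ ((x : ℂ) - (y : ℂ) * Complex.I) =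
      ∫ u : ℝ, η (x - u) *
        (ψ ((u : ℂ) + (y : ℂ) * Complex.I) - ψ ((u : ℂ) - (y : ℂ) * Complex.I)) := by
  rw [hconv, hconv, ← integral_sub (integrable_mul_comp_sub hη hηc hψ (add_mul_I_mem hy x))
    (integrable_mul_comp_sub hη hηc hψ (sub_mul_I_mem hy x)), ← integral_sub_left_eq_self _ _ x]
  congr 1
  ext u
  rw [← mul_sub]
  congr 3 <;> (push_cast; ring)

/-- The derivative of the mollification is the mollification by `η'`, hence bounded. Its jump at `x`
tends to zero because the translated test function is supported within `δ` of `x`, still inside the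
`4δ`-interval. -/
theorem differentiableOn_extendFrom_hconv {ψ : ℂ → ℂ} (hψ : DifferentiableOn ℂ ψ imaginaryDomain)
    {x₀ δ C : ℝ} (hδ : 0 < δ)
    (hC : ∀ z ∈ imaginaryDomain, z ∈ Metric.ball (x₀ : ℂ) (4 * δ) → |z.im| * ‖ψ z‖ ≤ C)
    (hjump : ∀ f : ℝ → ℂ, ContDiff ℝ ((⊤ : ℕ∞) : WithTop ℕ∞) f → HasCompactSupport f →
      tsupport f ⊆ Metric.ball x₀ (4 * δ) → Tendsto (fun y : ℝ => ∫ x : ℝ, f x *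
        (ψ ((x : ℂ) + (y : ℂ) * Complex.I) - ψ ((x : ℂ) - (y : ℂ) * Complex.I))) (𝓝[>] 0) (𝓝 0))
    {η : ℝ → ℂ} (hη : ContDiff ℝ ((⊤ : ℕ∞) : WithTop ℕ∞) η) (hηc : HasCompactSupport η)
    (hηδ : ∀ t, η t ≠ 0 → |t| ≤ δ) :
    DifferentiableOn ℂ (extendFrom imaginaryDomain (hconv η ψ)) (Metric.ball (x₀ : ℂ) (2 * δ)) := by
  have hη1 : ContDiff ℝ 1 η := hη.of_le (by exact_mod_cast le_top)
  have hη2 : ContDiff ℝ 2 (deriv η) :=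
    (contDiff_infty_iff_deriv.1 hη).2.of_le
      (mod_cast le_top : ((2 : ℕ∞) : WithTop ℕ∞) ≤ ((⊤ : ℕ∞) : WithTop ℕ∞))
  have hder : ∀ z ∈ imaginaryDomain, HasDerivAt (hconv η ψ) (hconv (deriv η) ψ z) z :=
    fun z hz => hasDerivAt_hconv hη1 hηc hψ hz
  obtain ⟨M, hM⟩ := exists_norm_hconv_le hψ hδ hC hη2 hηc.deriv (deriv_eq_zero_of_support hηδ)
  refine differentiableOn_extendFrom_of_bounded_deriv (M := M)
    (fun z hz => (hder z hz).differentiableAt.differentiableWithinAt) (fun z hz => ?_)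
    fun x hx => ?_
  · rw [(hder z hz.2).deriv]
    have h1 : ‖z - x₀‖ < 2 * δ := by simpa [dist_eq_norm] using hz.1
    refine hM z hz.2 ?_ ?_
    · have h2 := Complex.abs_re_le_norm (z - x₀)
      simp only [Complex.sub_re, Complex.ofReal_re] at h2
      linarith
    · have h2 := Complex.abs_im_le_norm (z - x₀)
      simp only [Complex.sub_im, Complex.ofReal_im, sub_zero] at h2
      linarith
  · have hx' : |x - x₀| < 2 * δ := by
      have : ‖((x - x₀ : ℝ) : ℂ)‖ < 2 * δ := by
        push_cast; simpa [dist_eq_norm] using hx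
      rwa [Complex.norm_real, Real.norm_eq_abs] at this
    have hsupp : tsupport (fun u => η (x - u)) ⊆ Metric.closedBall x δ := by
      refine closure_minimal (fun u hu => ?_) Metric.isClosed_closedBall
      have := hηδ _ hu
      rwa [Metric.mem_closedBall, Real.dist_eq, abs_sub_comm]
    refine (hjump (fun u => η (x - u)) (hη.comp (contDiff_const.sub contDiff_id)) ?_
      (hsupp.trans fun u hu => ?_)).congr' ?_
    · exact (isCompact_closedBall x δ).of_isClosed_subset (isClosed_tsupport _) hsupp
    · rw [Metric.mem_closedBall, Real.dist_eq, abs_le] at hu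
      rw [Metric.mem_ball, Real.dist_eq, abs_lt]
      rw [abs_lt] at hx'
      constructor <;> linarith
    · filter_upwards [self_mem_nhdsWithin] with y hy
      exact (hconv_sub_hconv hψ.continuousOn hη.continuous hηc x (ne_of_gt hy)).symm

/-! ### Removing the mollification -/

/-- On the circle of radius `r` about a real point, the weight `(z - c)² - r²` has modulus
`2 r |Im z|`. -/
theorem norm_weight_eq {c r : ℝ} {z : ℂ} (hz : ‖z - c‖ = r) :
    ‖(z - c) ^ 2 - (r : ℂ) ^ 2‖ = 2 * r * |z.im| := by
  have h1 : (r : ℂ) ^ 2 = (z - c) * (starRingEnd ℂ) (z - c) := by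
    rw [Complex.mul_conj, Complex.normSq_eq_norm_sq, hz]; push_cast; ring
  have h2 : (z - c) ^ 2 - (r : ℂ) ^ 2 = (z - c) * (2 * z.im * Complex.I) := by
    rw [h1, sq, ← mul_sub, Complex.sub_conj]
    simp
  rw [h2, norm_mul, hz]
  simp only [norm_mul, Complex.norm_I, Complex.norm_real, Real.norm_eq_abs]
  simp
  ring

theorem weight_ne_zero {c r : ℝ} {z : ℂ} (hz : ‖z - c‖ < r) : (z - c) ^ 2 - (r : ℂ) ^ 2 ≠ 0 := by
  intro h
  have h1 : ‖(z - c) ^ 2‖ = ‖(r : ℂ) ^ 2‖ := by rw [sub_eq_zero.1 h]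
  have hr : 0 < r := (norm_nonneg _).trans_lt hz
  rw [norm_pow, norm_pow, Complex.norm_real, Real.norm_of_nonneg hr.le] at h1
  have := pow_lt_pow_left₀ hz (norm_nonneg _) two_ne_zero
  linarith

theorem tendsto_hconv_normed {ψ : ℂ → ℂ} (hψ : ContinuousOn ψ imaginaryDomain)
    {b : ℕ → ContDiffBump (0 : ℝ)} (hb : Tendsto (fun n => (b n).rOut) atTop (𝓝 0))
    {z : ℂ} (hz : z ∈ imaginaryDomain) :
    Tendsto (fun n => hconv (fun t => ((b n).normed volume t : ℂ)) ψ z) atTop (𝓝 (ψ z)) := by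
  have hc : Continuous fun u : ℝ => ψ ((u : ℂ) + (z.im : ℂ) * Complex.I) :=
    hψ.comp_continuous (by fun_prop) fun u => add_mul_I_mem hz u
  have h1 := ContDiffBump.convolution_tendsto_right_of_continuous (μ := volume) hb hc z.re
  simp only [Complex.re_add_im] at h1
  refine h1.congr fun n => ?_
  rw [convolution, hconv]
  congr 1
  ext t
  rw [ContinuousLinearMap.lsmul_apply, Complex.real_smul]
  congr 2
  push_cast
  rw [sub_add_eq_add_sub, Complex.re_add_im]

/-- Limits of holomorphic functions on a closed disk which converge boundedly on the circle. -/
theorem exists_differentiableOn_of_tendsto_circle {c : ℂ} {r B : ℝ} (hr : 0 < r)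
    {F : ℕ → ℂ → ℂ} {f : ℂ → ℂ} (hF : ∀ n, DifferentiableOn ℂ (F n) (Metric.closedBall c r))
    (hB : ∀ n, ∀ z ∈ Metric.sphere c r, ‖F n z‖ ≤ B)
    (hlim : ∀ z ∈ Metric.sphere c r, Tendsto (fun n => F n z) atTop (𝓝 (f z))) :
    ∃ G : ℂ → ℂ, DifferentiableOn ℂ G (Metric.ball c r) ∧
      ∀ w ∈ Metric.ball c r, Tendsto (fun n => F n w) atTop (𝓝 (G w)) := by
  have hmem : ∀ θ : ℝ, circleMap c r θ ∈ Metric.sphere c r := fun θ =>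
    circleMap_mem_sphere c hr.le θ
  have hcont : ∀ n, Continuous fun θ : ℝ => F n (circleMap c r θ) := fun n =>
    (hF n).continuousOn.comp_continuous (continuous_circleMap c r) fun θ =>
      Metric.sphere_subset_closedBall (hmem θ)
  have hmeas : AEStronglyMeasurable (fun θ : ℝ => f (circleMap c r θ)) volume :=
    aestronglyMeasurable_of_tendsto_ae atTop (fun n => (hcont n).aestronglyMeasurable)
      (Eventually.of_forall fun θ => hlim _ (hmem θ))
  have hfB : ∀ z ∈ Metric.sphere c r, ‖f z‖ ≤ B := fun z hz =>
    le_of_tendsto (hlim z hz).norm (Eventually.of_forall fun n => hB n z hz)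
  have hint : CircleIntegrable f c r := by
    rw [CircleIntegrable, intervalIntegrable_iff]
    exact IntegrableOn.of_bound
      (by rw [Set.uIoc_of_le Real.two_pi_pos.le]; exact measure_Ioc_lt_top) hmeas.restrict B
      (Eventually.of_forall fun θ => hfB _ (hmem θ))
  lift r to NNReal using hr.le
  -- The limit in the disk is the Cauchy integral of the boundary limit, for which bounded and
  -- measurable is enough; no continuity of `f` is needed.
  have hps := hasFPowerSeriesOn_cauchy_integral hint hr
  have hd := hps.differentiableOn
  rw [Metric.eball_coe] at hd
  refine ⟨_, hd, fun w hw => ?_⟩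
  have h1 : Tendsto (fun n => ∮ z in C(c, r), (z - w)⁻¹ • F n z) atTop
      (𝓝 (∮ z in C(c, r), (z - w)⁻¹ • f z)) := by
    have hne : ∀ θ : ℝ, circleMap c r θ - w ≠ 0 := fun θ h =>
      circleMap_ne_mem_ball hw θ (sub_eq_zero.1 h)
    have hcw : Continuous fun θ : ℝ => ‖(circleMap c r θ - w)⁻¹‖ * B :=
      (((continuous_circleMap c r).sub continuous_const).inv₀ hne).norm.mul continuous_const
    unfold circleIntegral
    refine intervalIntegral.tendsto_integral_filter_of_dominated_convergence
      (fun θ => r * (‖(circleMap c r θ - w)⁻¹‖ * B)) (Eventually.of_forall fun n => ?_)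
      (Eventually.of_forall fun n => Eventually.of_forall fun θ _ => ?_)
      ((continuous_const.mul hcw).intervalIntegrable _ _)
      (Eventually.of_forall fun θ _ => ((hlim _ (hmem θ)).const_smul _).const_smul _)
    · refine Continuous.aestronglyMeasurable ?_
      simp only [deriv_circleMap]
      exact ((continuous_circleMap 0 r).mul continuous_const).smul
        ((((continuous_circleMap c r).sub continuous_const).inv₀ hne).smul (hcont n))
    · rw [norm_smul, norm_smul, deriv_circleMap]
      simp only [norm_mul, norm_circleMap_zero, Complex.norm_I, mul_one, NNReal.abs_eq]
      gcongr
      exact hB n _ (hmem θ)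
  have h2 := h1.const_smul (2 * (Real.pi : ℂ) * Complex.I)⁻¹
  refine h2.congr fun n => ?_
  rw [(hF n).circleIntegral_sub_inv_smul hw, inv_smul_smul₀]
  simp [Real.pi_ne_zero]

/-- A holomorphic function on `ℂ ∖ ℝ` which behaves simply near a real point and has vanishing
distributional jump there extends holomorphically across the real line near this point. -/
theorem exists_extension_of_jump_eq_zero {ψ : ℂ → ℂ} (hψ : DifferentiableOn ℂ ψ imaginaryDomain)
    {x₀ δ C : ℝ} (hδ : 0 < δ)
    (hC : ∀ z ∈ imaginaryDomain, z ∈ Metric.ball (x₀ : ℂ) (4 * δ) → |z.im| * ‖ψ z‖ ≤ C)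
    (hjump : ∀ f : ℝ → ℂ, ContDiff ℝ ((⊤ : ℕ∞) : WithTop ℕ∞) f → HasCompactSupport f →
      tsupport f ⊆ Metric.ball x₀ (4 * δ) → Tendsto (fun y : ℝ => ∫ x : ℝ, f x *
        (ψ ((x : ℂ) + (y : ℂ) * Complex.I) - ψ ((x : ℂ) - (y : ℂ) * Complex.I))) (𝓝[>] 0) (𝓝 0)) :
    ∃ G : ℂ → ℂ, DifferentiableOn ℂ G (Metric.ball (x₀ : ℂ) δ) ∧
      ∀ z ∈ Metric.ball (x₀ : ℂ) δ ∩ imaginaryDomain, G z = ψ z := by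
  let b : ℕ → ContDiffBump (0 : ℝ) := fun n =>
    ⟨δ / (n + 2), δ / (n + 1), by positivity, by gcongr; linarith⟩
  have hb : Tendsto (fun n => (b n).rOut) atTop (𝓝 0) := by
    have := (tendsto_one_div_add_atTop_nhds_zero_nat (𝕜 := ℝ)).const_mul δ
    simpa [b, div_eq_mul_inv] using this
  set η : ℕ → ℝ → ℂ := fun n t => ((b n).normed volume t : ℂ) with hη
  have hηs : ∀ n, ContDiff ℝ ((⊤ : ℕ∞) : WithTop ℕ∞) (η n) := fun n =>
    Complex.ofRealCLM.contDiff.comp (b n).contDiff_normed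
  have hηc : ∀ n, HasCompactSupport (η n) := fun n =>
    (b n).hasCompactSupport_normed.comp_left Complex.ofReal_zero
  have hηδ : ∀ n t, η n t ≠ 0 → |t| ≤ δ := fun n t ht => by
    have h1 : t ∈ Function.support ((b n).normed volume) := fun h => ht (by simp [hη, h])
    rw [(b n).support_normed_eq, mem_ball_zero_iff, Real.norm_eq_abs] at h1
    refine h1.le.trans ?_
    exact div_le_self hδ.le (by simp)
  have hη1 : ∀ n, ∫ t, ‖η n t‖ = 1 := fun n => by
    have : ∀ t, ‖η n t‖ = (b n).normed volume t := fun t => by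
      rw [hη, Complex.norm_real, Real.norm_of_nonneg ((b n).nonneg_normed t)]
    simp_rw [this]
    exact (b n).integral_normed
  -- On the circle the mollified functions are controlled only by `C/|Im z|`. The weight `p`
  -- vanishes exactly at the two real points and turns this into the uniform bound `2δC`.
  set p : ℂ → ℂ := fun z => (z - x₀) ^ 2 - (δ : ℂ) ^ 2 with hp
  set E : ℕ → ℂ → ℂ := fun n => extendFrom imaginaryDomain (hconv (η n) ψ) with hE
  have hEd : ∀ n, DifferentiableOn ℂ (E n) (Metric.ball (x₀ : ℂ) (2 * δ)) := fun n =>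
    differentiableOn_extendFrom_hconv hψ hδ hC hjump (hηs n) (hηc n) (hηδ n)
  have hEeq : ∀ n, ∀ z ∈ imaginaryDomain, E n z = hconv (η n) ψ z := fun n =>
    extendFrom_extends fun z hz => (hasDerivAt_hconv ((hηs n).of_le (by exact_mod_cast le_top))
      (hηc n) hψ hz).continuousAt.continuousWithinAt
  have hElim : ∀ z ∈ imaginaryDomain, Tendsto (fun n => E n z) atTop (𝓝 (ψ z)) := fun z hz =>
    (tendsto_hconv_normed hψ.continuousOn hb hz).congr fun n => (hEeq n z hz).symm
  classical
  have hbound : ∀ n, ∀ z ∈ Metric.sphere (x₀ : ℂ) δ, ‖p z * E n z‖ ≤ 2 * δ * C := by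
    intro n z hz
    have hzr : ‖z - x₀‖ = δ := by simpa [dist_eq_norm] using hz
    rw [norm_mul, hp]
    simp only
    rw [norm_weight_eq hzr]
    by_cases hzi : z ∈ imaginaryDomain
    · have h1 := Complex.abs_re_le_norm (z - x₀)
      have h2 := Complex.abs_im_le_norm (z - x₀)
      simp only [Complex.sub_re, Complex.ofReal_re, Complex.sub_im, Complex.ofReal_im,
        sub_zero] at h1 h2
      have h3 := norm_im_mul_hconv_le hδ hC (hηs n).continuous (hηc n) (hηδ n) hzi
        (by linarith) (by linarith)
      rw [hη1, mul_one] at h3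
      rw [hEeq n z hzi, mul_assoc]
      gcongr
    · have hz0 : z.im = 0 := by simpa [imaginaryDomain] using hzi
      have hC0 : 0 ≤ C := by
        refine le_trans ?_ (hC ((x₀ : ℂ) + (δ : ℂ) * Complex.I) (add_mul_I_mem hδ.ne' x₀) ?_)
        · positivity
        · simp [dist_eq_norm, abs_of_pos hδ]; linarith
      rw [hz0, abs_zero, mul_zero, zero_mul]
      positivity
  have hlim : ∀ z ∈ Metric.sphere (x₀ : ℂ) δ, Tendsto (fun n => p z * E n z) atTop
      (𝓝 (if z ∈ imaginaryDomain then p z * ψ z else 0)) := by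
    intro z hz
    by_cases hzi : z ∈ imaginaryDomain
    · simp only [hzi, if_true]
      exact (hElim z hzi).const_mul _
    · have hz0 : z.im = 0 := by simpa [imaginaryDomain] using hzi
      have hp0 : p z = 0 := by
        rw [← norm_eq_zero, hp]
        simp only
        rw [norm_weight_eq (by simpa [dist_eq_norm] using hz), hz0]
        simp
      simp only [hzi, if_false, hp0, zero_mul]
      exact tendsto_const_nhds
  obtain ⟨G, hG, hGlim⟩ := exists_differentiableOn_of_tendsto_circle (c := (x₀ : ℂ)) (B := 2 * δ * C)
    (F := fun n z => p z * E n z) (f := fun z => if z ∈ imaginaryDomain then p z * ψ z else 0) hδ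
    (fun n => (by fun_prop : Differentiable ℂ p).differentiableOn.mul ((hEd n).mono
      (Metric.closedBall_subset_ball (by linarith)))) hbound hlim
  -- The weight has no zero inside the disk, so it can be divided out of the limit.
  refine ⟨fun z => G z / p z, hG.div (by fun_prop) fun z hz => ?_, fun z hz => ?_⟩
  · exact weight_ne_zero (by simpa [dist_eq_norm] using hz)
  · have hpz : p z ≠ 0 := weight_ne_zero (by simpa [dist_eq_norm] using hz.1)
    rw [div_eq_iff hpz, mul_comm]
    exact tendsto_nhds_unique (hGlim z hz.1) ((hElim z hz.2).const_mul _)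

/-! ### Growth at isolated singularities -/

/-- Apply the maximum principle to `((z - c)² - ρ²) g(z)`: its modulus is at most `2ρM` on the
circle, while the weight is at least `3ρ²/4` on the half-size disk. -/
theorem norm_le_of_norm_im_mul_le_sphere {g : ℂ → ℂ} {c ρ M : ℝ} (hρ : 0 < ρ)
    (hg : DifferentiableOn ℂ g (Metric.closedBall (c : ℂ) ρ))
    (hM : ∀ z ∈ Metric.sphere (c : ℂ) ρ, |z.im| * ‖g z‖ ≤ M) {w : ℂ} (hw : ‖w - c‖ ≤ ρ / 2) :
    3 * ρ * ‖g w‖ ≤ 8 * M := by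
  have hd : DifferentiableOn ℂ (fun z => ((z - c) ^ 2 - (ρ : ℂ) ^ 2) * g z)
      (Metric.closedBall (c : ℂ) ρ) :=
    DifferentiableOn.mul (by fun_prop) hg
  have h1 := Complex.norm_le_of_forall_mem_frontier_norm_le (C := 2 * ρ * M)
    (Metric.isBounded_ball (x := (c : ℂ)) (r := ρ))
    (hd.mono (closure_ball (c : ℂ) hρ.ne').le).diffContOnCl (fun z hz => by
      rw [frontier_ball _ hρ.ne'] at hz
      rw [norm_mul, norm_weight_eq (by simpa [dist_eq_norm] using hz), mul_assoc]
      gcongr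
      exact hM z hz) (z := w) (subset_closure (by
        rw [mem_ball_iff_norm]; linarith))
  have h2 : ρ ^ 2 - (ρ / 2) ^ 2 ≤ ‖(w - c) ^ 2 - (ρ : ℂ) ^ 2‖ := by
    have h3 := norm_sub_norm_le ((ρ : ℂ) ^ 2) ((w - c) ^ 2)
    rw [norm_sub_rev, norm_pow, norm_pow, Complex.norm_real, Real.norm_of_nonneg hρ.le] at h3
    have h4 : ‖w - c‖ ^ 2 ≤ (ρ / 2) ^ 2 := by gcongr
    linarith
  rw [norm_mul] at h1
  have h5 : (ρ ^ 2 - (ρ / 2) ^ 2) * ‖g w‖ ≤ 2 * ρ * M :=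
    (mul_le_mul_of_nonneg_right h2 (norm_nonneg _)).trans h1
  nlinarith

theorem norm_sub_re_le (w : ℂ) : ‖w - (w.re : ℂ)‖ = |w.im| := by
  have : w - (w.re : ℂ) = (w.im : ℂ) * Complex.I := by
    rw [sub_eq_iff_eq_add']; exact (Complex.re_add_im w).symm
  rw [this, norm_mul, Complex.norm_I, mul_one, Complex.norm_real, Real.norm_eq_abs]

/-- The key growth estimate: a holomorphic function bounded by `M / |Im z|` on an annulus
`5/8 d ≤ |z - σ| ≤ 5/4 d` is bounded by `11 M / d` on the circle `|z - σ| = d`. -/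
theorem norm_le_of_norm_im_mul_le_annulus {g : ℂ → ℂ} {σ d M : ℝ} (hd : 0 < d)
    (hg : ∀ z : ℂ, 5 / 8 * d ≤ ‖z - σ‖ → ‖z - σ‖ ≤ 5 / 4 * d → DifferentiableAt ℂ g z)
    (hM : ∀ z : ℂ, 5 / 8 * d ≤ ‖z - σ‖ → ‖z - σ‖ ≤ 5 / 4 * d → |z.im| * ‖g z‖ ≤ M)
    {w : ℂ} (hw : ‖w - σ‖ = d) : d * ‖g w‖ ≤ 11 * M := by
  have hM0 : 0 ≤ M := (by positivity : 0 ≤ |w.im| * ‖g w‖).trans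
    (hM w (by rw [hw]; linarith) (by rw [hw]; linarith))
  -- Away from the real line the hypothesis gives the bound directly, with constant `8`. Near it,
  -- the disk of radius `d/4` about `Re w` lies in the annulus (`7/8 - 1/4 = 5/8`), and the previous
  -- estimate gives `32/3 ≤ 11`.
  rcases le_or_gt (d / 8) |w.im| with h | h
  · have h1 := hM w (by rw [hw]; linarith) (by rw [hw]; linarith)
    have h2 : d / 8 * ‖g w‖ ≤ |w.im| * ‖g w‖ := by gcongr
    linarith
  · have hin : ∀ z ∈ Metric.closedBall ((w.re : ℝ) : ℂ) (d / 4),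
        5 / 8 * d ≤ ‖z - σ‖ ∧ ‖z - σ‖ ≤ 5 / 4 * d := by
      intro z hz
      rw [mem_closedBall_iff_norm] at hz
      have h1 : ‖(w.re : ℂ) - σ‖ ≤ d := by
        rw [← hw, ← Complex.ofReal_sub, Complex.norm_real]
        simpa using Complex.abs_re_le_norm (w - σ)
      have h2 : d - d / 8 ≤ ‖(w.re : ℂ) - σ‖ := by
        have h3 := norm_sub_norm_le (w - σ) (w - (w.re : ℂ))
        rw [hw, norm_sub_re_le, sub_sub_sub_cancel_left] at h3
        linarith
      have e : z - σ = ((w.re : ℂ) - σ) + (z - (w.re : ℂ)) := by ring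
      constructor
      · have h3 := norm_sub_le_norm_add ((w.re : ℂ) - σ) (z - (w.re : ℂ))
        rw [← e] at h3
        linarith
      · rw [e]
        refine (norm_add_le _ _).trans ?_
        linarith
    have h1 := norm_le_of_norm_im_mul_le_sphere (g := g) (c := w.re) (ρ := d / 4) (M := M)
      (by positivity)
      (fun z hz => (hg z (hin z hz).1 (hin z hz).2).differentiableWithinAt)
      (fun z hz => hM z (hin z (Metric.sphere_subset_closedBall hz)).1
        (hin z (Metric.sphere_subset_closedBall hz)).2) (w := w)
      (by rw [norm_sub_re_le]; linarith)
    nlinarith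

open Asymptotics

/-- The annulus estimate with `d = |w - σ|` turns growth `1/|Im z|` into growth `1/|z - σ|`: an
isolated real singularity is at most a simple pole. -/
theorem isBigO_one_mul_of_norm_im_mul_le {g : ℂ → ℂ} {σ R C : ℝ} (hR : 0 < R)
    (hg : ∀ z : ℂ, z ≠ σ → ‖z - σ‖ < R → DifferentiableAt ℂ g z)
    (hC : ∀ z : ℂ, z ≠ σ → ‖z - σ‖ < R → |z.im| * ‖g z‖ ≤ C) :
    (fun z => (z - σ) * g z) =O[𝓝[≠] (σ : ℂ)] fun _ => (1 : ℝ) := by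
  refine IsBigO.of_bound (11 * C) ?_
  filter_upwards [self_mem_nhdsWithin,
    nhdsWithin_le_nhds (Metric.ball_mem_nhds (σ : ℂ) (half_pos hR))] with w hw hwR
  rw [mem_ball_iff_norm] at hwR
  have hd : 0 < ‖w - σ‖ := norm_pos_iff.2 (sub_ne_zero.2 hw)
  have hne : ∀ z : ℂ, 5 / 8 * ‖w - σ‖ ≤ ‖z - σ‖ → z ≠ σ := fun z hz h => by
    rw [h, sub_self, norm_zero] at hz; linarith
  rw [norm_mul, norm_one, mul_one]
  exact norm_le_of_norm_im_mul_le_annulus hd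
    (fun z h1 h2 => hg z (hne z h1) (by linarith))
    (fun z h1 h2 => hC z (hne z h1) (by linarith)) rfl

theorem isBigO_cobounded_of_norm_im_mul_le {g : ℂ → ℂ} {R C : ℝ}
    (hg : ∀ z : ℂ, R < ‖z‖ → DifferentiableAt ℂ g z)
    (hC : ∀ z : ℂ, R < ‖z‖ → |z.im| * ‖g z‖ ≤ C * ‖z‖ ^ 2) :
    g =O[Bornology.cobounded ℂ] fun z => z := by
  refine IsBigO.of_bound (11 * (2 * C)) ?_
  filter_upwards [eventually_cobounded_le_norm (2 * |R| + 1)] with w hw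
  have hd : 0 < ‖w‖ := by have := abs_nonneg R; linarith
  have hR : R ≤ |R| := le_abs_self R
  have hC0 : 0 ≤ C := by
    have h1 := (by positivity : 0 ≤ |w.im| * ‖g w‖).trans (hC w (by linarith [abs_nonneg R]))
    exact nonneg_of_mul_nonneg_left h1 (by positivity)
  -- The annulus about `0` with `d = |w|` is used; the factor `2` in `M` absorbs `(5/4)² = 25/16`.
  have key := norm_le_of_norm_im_mul_le_annulus (g := g) (σ := 0) (d := ‖w‖)
    (M := 2 * C * ‖w‖ ^ 2) hd
    (fun z h1 _ => hg z (by simp at h1; linarith))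
    (fun z h1 h2 => by
      simp only [Complex.ofReal_zero, sub_zero] at h1 h2
      refine (hC z (by linarith)).trans ?_
      have h3 : ‖z‖ ^ 2 ≤ (5 / 4 * ‖w‖) ^ 2 := by gcongr
      have h4 : C * ‖z‖ ^ 2 ≤ C * (5 / 4 * ‖w‖) ^ 2 := by gcongr
      have h5 : 0 ≤ C * ‖w‖ ^ 2 := by positivity
      nlinarith) (w := w) (by simp)
  refine le_of_mul_le_mul_left (key.trans_eq ?_) hd
  ring

/-! ### Liouville and rationality -/

/-- A function with finitely many singularities which are at most simple poles is a sum of an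
entire function and simple fractions. -/
theorem exists_eq_add_sum_div_sub (T : Finset ℂ) : ∀ g : ℂ → ℂ,
    DifferentiableOn ℂ g (T : Set ℂ)ᶜ →
    (∀ σ ∈ T, (fun z => (z - σ) * g z) =O[𝓝[≠] σ] fun _ => (1 : ℝ)) →
    ∃ (ρ : ℂ → ℂ) (h : ℂ → ℂ), Differentiable ℂ h ∧
      ∀ z ∉ T, g z = h z + ∑ σ ∈ T, ρ σ / (z - σ) := by
  classical
  induction T using Finset.induction_on with
  | empty =>
    intro g hg _
    exact ⟨0, g, by simpa [differentiableOn_univ] using hg, by simp⟩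
  | insert a T ha ih =>
    intro g hg hO
    set k : ℂ → ℂ := fun z => (z - a) * g z with hk
    have hTa : (T : Set ℂ)ᶜ ∈ 𝓝 a := T.finite_toSet.isClosed.isOpen_compl.mem_nhds (by simpa using ha)
    have hkd : DifferentiableOn ℂ k ((T : Set ℂ)ᶜ \ {a}) := by
      refine DifferentiableOn.mul (by fun_prop) (hg.mono fun z hz => ?_)
      simp only [Finset.coe_insert, Set.mem_compl_iff, Set.mem_insert_iff, not_or]
      exact ⟨hz.2, hz.1⟩
    have hko : (fun z => k z - k a) =o[𝓝[≠] a] fun z => (z - a)⁻¹ := by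
      have h1 : (fun z => k z - k a) =O[𝓝[≠] a] fun _ => (1 : ℝ) :=
        (hO a (Finset.mem_insert_self a T)).sub (isBigO_const_const _ one_ne_zero _)
      refine h1.trans_isLittleO ((isLittleO_const_left).2 (Or.inr ?_))
      have h2 : Tendsto (fun z => z - a) (𝓝[≠] a) (𝓝[≠] 0) := by
        refine tendsto_nhdsWithin_iff.2 ⟨?_, ?_⟩
        · have : Tendsto (fun z => z - a) (𝓝 a) (𝓝 (a - a)) :=
            (continuous_id.sub continuous_const).tendsto a
          rw [sub_self] at this
          exact this.mono_left nhdsWithin_le_nhds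
        · filter_upwards [self_mem_nhdsWithin] with z hz
          exact sub_ne_zero.2 hz
      exact tendsto_norm_cobounded_atTop.comp (tendsto_inv₀_nhdsNE_zero.comp h2)
    -- By Riemann's theorem `(z - a) g(z)` extends to `a` with value `L`, the residue. The divided
    -- slope of the extension is `g - L/(z - a)`, now holomorphic at `a`.
    set L := limUnder (𝓝[≠] a) k with hL
    have hK := Complex.differentiableOn_update_limUnder_of_isLittleO hTa hkd hko
    rw [← hL] at hK
    set K := Function.update k a L with hKdef
    have hslope : ∀ z, z ≠ a → dslope K a z = g z - L / (z - a) := by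
      intro z hz
      have hza : z - a ≠ 0 := sub_ne_zero.2 hz
      rw [dslope_of_ne _ hz, slope_def_field, hKdef, Function.update_of_ne hz, Function.update_self,
        hk]
      field_simp
    obtain ⟨ρ, h, hh, hgh⟩ := ih (dslope K a) ((Complex.differentiableOn_dslope hTa).2 hK) (by
      intro τ hτ
      have hτa : τ ≠ a := fun h => ha (h ▸ hτ)
      have h1 : (fun z => (z - τ) * (L / (z - a))) =O[𝓝[≠] τ] fun _ => (1 : ℝ) := by
        have hc : ContinuousAt (fun z => (z - τ) * (L / (z - a))) τ := by
          refine ContinuousAt.mul (by fun_prop) (ContinuousAt.div (by fun_prop) (by fun_prop) ?_)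
          exact sub_ne_zero.2 hτa
        exact (hc.tendsto.mono_left nhdsWithin_le_nhds).isBigO_one ℝ
      refine ((hO τ (Finset.mem_insert_of_mem hτ)).sub h1).congr' ?_ EventuallyEq.rfl
      filter_upwards [nhdsWithin_le_nhds (isOpen_ne.mem_nhds hτa)] with z hz
      rw [hslope z hz, mul_sub])
    refine ⟨Function.update ρ a L, h, hh, fun z hz => ?_⟩
    rw [Finset.mem_insert, not_or] at hz
    have h1 := hgh z hz.2
    rw [hslope z hz.1] at h1
    rw [Finset.sum_insert ha, Function.update_self]
    have h2 : ∑ σ ∈ T, Function.update ρ a L σ / (z - σ) = ∑ σ ∈ T, ρ σ / (z - σ) :=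
      Finset.sum_congr rfl fun σ hσ => by
        have hσa : σ ≠ a := fun h => ha (h ▸ hσ)
        rw [Function.update_of_ne hσa]
    rw [h2]
    linear_combination h1

/-- Liouville's theorem for entire functions of linear growth. -/
theorem exists_eq_add_mul_of_isBigO {h : ℂ → ℂ} (hh : Differentiable ℂ h)
    (hO : h =O[Bornology.cobounded ℂ] fun z => z) : ∃ a b : ℂ, ∀ z, h z = a + b * z := by
  have hd : Differentiable ℂ (dslope h 0) := by
    rw [← differentiableOn_univ] at hh ⊢
    exact (Complex.differentiableOn_dslope univ_mem).2 hh
  have hbd : Bornology.IsBounded (Set.range (dslope h 0)) := by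
    obtain ⟨C, hC⟩ := hO.bound
    have hev : ∀ᶠ z in Bornology.cobounded ℂ, ‖dslope h 0 z‖ ≤ C + ‖h 0‖ := by
      filter_upwards [hC, eventually_cobounded_le_norm 1] with z hz hz1
      have hz0 : z ≠ 0 := by
        rintro rfl; norm_num at hz1
      rw [dslope_of_ne _ hz0, slope_def_field, sub_zero, norm_div,
        div_le_iff₀ (by linarith)]
      refine (norm_sub_le _ _).trans ?_
      nlinarith [norm_nonneg (h 0)]
    obtain ⟨R, -, hR⟩ := (hasBasis_cobounded_norm (E := ℂ)).mem_iff.1 hev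
    obtain ⟨M, hM⟩ := (isCompact_closedBall (0 : ℂ) R).exists_bound_of_continuousOn
      hd.continuous.continuousOn
    refine isBounded_iff_forall_norm_le.2 ⟨max M (C + ‖h 0‖), ?_⟩
    rintro _ ⟨z, rfl⟩
    rcases le_total ‖z‖ R with hz | hz
    · exact (hM z (by simpa using hz)).trans (le_max_left _ _)
    · exact le_trans (hR hz) (le_max_right _ _)
  obtain ⟨b, hb⟩ := hd.exists_const_forall_eq_of_bounded hbd
  refine ⟨h 0, b, fun z => ?_⟩
  by_cases hz : z = 0
  · simp [hz]
  · have h1 := hb z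
    rw [dslope_of_ne _ hz, slope_def_field, sub_zero, div_eq_iff hz] at h1
    linear_combination h1

theorem exists_norm_im_mul_le_of_behavesSimplyAt_infty {φ : ℂ → ℂ}
    (h : BehavesSimplyAt (fun z => φ (-1 / z)) 0) :
    ∃ R C : ℝ, ∀ w ∈ imaginaryDomain, R < ‖w‖ → |w.im| * ‖φ w‖ ≤ C * ‖w‖ ^ 2 := by
  obtain ⟨U, hU, C, hC⟩ := h
  obtain ⟨ε, hε, hεU⟩ := Metric.mem_nhds_iff.1 hU
  refine ⟨ε⁻¹, C, fun w hw hwR => ?_⟩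
  have hw0 : 0 < ‖w‖ := (inv_pos.2 hε).trans hwR
  have hwne : w ≠ 0 := norm_pos_iff.1 hw0
  have h1 := hC (-1 / w) ⟨hεU ?_, neg_one_div_mem_imaginaryDomain hw⟩
  · have e : -1 / (-1 / w) = w := by field_simp
    beta_reduce at h1
    rw [e, norm_mul, Complex.norm_real, Real.norm_eq_abs, im_neg_one_div, abs_div,
      abs_of_nonneg (sq_nonneg ‖w‖), div_mul_eq_mul_div, div_le_iff₀ (by positivity)] at h1
    exact h1
  · rw [mem_ball_iff_norm, Complex.ofReal_zero, sub_zero, norm_div, norm_neg, norm_one, one_div]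
    exact inv_lt_of_inv_lt₀ hε hwR

/-- The extension by limits is canonical: it coincides with every local holomorphic continuation, so
the local ones glue without further argument. -/
theorem differentiableAt_extendFrom_of_extension {ψ : ℂ → ℂ} {x r : ℝ} (hr : 0 < r) {G : ℂ → ℂ}
    (hG : DifferentiableOn ℂ G (Metric.ball (x : ℂ) r))
    (hGψ : ∀ z ∈ Metric.ball (x : ℂ) r ∩ imaginaryDomain, G z = ψ z) :
    DifferentiableAt ℂ (extendFrom imaginaryDomain ψ) x := by
  have heq : ∀ z ∈ Metric.ball (x : ℂ) r, extendFrom imaginaryDomain ψ z = G z := by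
    intro z hz
    have hzb : Metric.ball (x : ℂ) r ∈ 𝓝 z := Metric.isOpen_ball.mem_nhds hz
    refine extendFrom_eq (dense_imaginaryDomain z) ?_
    refine Tendsto.congr' ?_
      (((hG.differentiableAt hzb).continuousAt.tendsto).mono_left nhdsWithin_le_nhds)
    filter_upwards [self_mem_nhdsWithin, nhdsWithin_le_nhds hzb] with u hu hub
    exact hGψ u ⟨hub, hu⟩
  have hxb := Metric.ball_mem_nhds (x : ℂ) hr
  exact (hG.differentiableAt hxb).congr_of_eventuallyEq
    (eventually_of_mem hxb heq)

/-- A function which behaves simply on `ℝ ⊔ {∞}` and has vanishing distributional jump off a finite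
set is rational, with at most simple poles. -/
theorem exists_eq_rational_of_jump_eq_zero {ψ : ℂ → ℂ} (hψ : DifferentiableOn ℂ ψ imaginaryDomain)
    (hs : BehavesSimply ψ) {S : Set ℝ} (hS : IsOpen S) (hT : Sᶜ.Finite)
    (hjump : ∀ f : ℝ → ℂ, ContDiff ℝ ((⊤ : ℕ∞) : WithTop ℕ∞) f → HasCompactSupport f →
      tsupport f ⊆ S → Tendsto (fun y : ℝ => ∫ x : ℝ, f x *
        (ψ ((x : ℂ) + (y : ℂ) * Complex.I) - ψ ((x : ℂ) - (y : ℂ) * Complex.I))) (𝓝[>] 0) (𝓝 0)) :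
    ∃ (a b : ℂ) (ρ : ℝ → ℂ), ∀ z ∈ imaginaryDomain,
      ψ z = a + b * z + ∑ σ ∈ hT.toFinset, ρ σ / (z - σ) := by
  classical
  set E := extendFrom imaginaryDomain ψ with hE
  have hEψ : ∀ z ∈ imaginaryDomain, E z = ψ z := extendFrom_extends hψ.continuousOn
  set T : Finset ℂ := hT.toFinset.image (fun x : ℝ => (x : ℂ)) with hTdef
  have hreal : ∀ z ∉ imaginaryDomain, z = ((z.re : ℝ) : ℂ) := fun z hz => by
    have : z.im = 0 := by simpa [imaginaryDomain] using hz
    exact Complex.ext (by simp) (by simp [this])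
  have hloc : ∀ s : ℝ, ∃ U ∈ 𝓝 (s : ℂ), ∃ C : ℝ, ∀ z ∈ U ∩ imaginaryDomain,
      |z.im| * ‖ψ z‖ ≤ C := fun s => by
    obtain ⟨U, hU, C, hC⟩ := hs.1 s
    refine ⟨U, hU, C, fun z hz => ?_⟩
    simpa [norm_mul, Complex.norm_real] using hC z hz
  have hEd : ∀ z ∉ T, DifferentiableAt ℂ E z := by
    intro z hz
    by_cases hzi : z ∈ imaginaryDomain
    · have hn := isOpen_imaginaryDomain.mem_nhds hzi
      exact (hψ.differentiableAt hn).congr_of_eventuallyEq (eventually_of_mem hn hEψ)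
    · rw [hreal z hzi] at hz ⊢
      set x := z.re
      have hxS : x ∈ S := by
        by_contra h
        exact hz (Finset.mem_image_of_mem _ (hT.mem_toFinset.2 h))
      obtain ⟨U, hU, C, hC⟩ := hloc x
      obtain ⟨ε₁, hε₁, h1⟩ := Metric.mem_nhds_iff.1 hU
      obtain ⟨ε₂, hε₂, h2⟩ := Metric.isOpen_iff.1 hS x hxS
      set δ := min ε₁ ε₂ / 4 with hδ
      have hδ0 : 0 < δ := by have := lt_min hε₁ hε₂; positivity
      have hδ4 : 4 * δ = min ε₁ ε₂ := by rw [hδ]; ring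
      obtain ⟨G, hG, hGψ⟩ := exists_extension_of_jump_eq_zero hψ (x₀ := x) (C := C) hδ0
        (fun w hw hwb => hC w ⟨h1 (Metric.ball_subset_ball (hδ4.le.trans (min_le_left _ _)) hwb), hw⟩)
        (fun f hf hfc hfs => hjump f hf hfc ((hfs.trans
          (Metric.ball_subset_ball (hδ4.le.trans (min_le_right _ _)))).trans h2))
      exact differentiableAt_extendFrom_of_extension hδ0 hG hGψ
  -- At real points the left side is zero, whatever value `E` takes there; `|C|` covers a possibly
  -- negative `C`.
  have hEC : ∀ {z : ℂ} {C : ℝ}, (z ∈ imaginaryDomain → |z.im| * ‖ψ z‖ ≤ C) →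
      |z.im| * ‖E z‖ ≤ |C| := by
    intro z C h
    by_cases hzi : z ∈ imaginaryDomain
    · rw [hEψ z hzi]; exact (h hzi).trans (le_abs_self C)
    · have : z.im = 0 := by simpa [imaginaryDomain] using hzi
      simp [this]
  have hpole : ∀ σ ∈ T, (fun z => (z - σ) * E z) =O[𝓝[≠] σ] fun _ => (1 : ℝ) := by
    intro σ hσ
    obtain ⟨s, -, rfl⟩ := Finset.mem_image.1 hσ
    obtain ⟨U, hU, C, hC⟩ := hloc s
    have hcl : ((T.erase (s : ℂ) : Finset ℂ) : Set ℂ)ᶜ ∈ 𝓝 (s : ℂ) :=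
      (Finset.finite_toSet _).isClosed.isOpen_compl.mem_nhds (by simp)
    obtain ⟨R, hR, hRU⟩ := Metric.mem_nhds_iff.1 (inter_mem hU hcl)
    refine isBigO_one_mul_of_norm_im_mul_le (R := R) (C := |C|) hR (fun z hz hzR => ?_)
      (fun z hz hzR => ?_)
    · refine hEd z fun hzT => (hRU (mem_ball_iff_norm.2 hzR)).2 ?_
      exact Finset.mem_coe.2 (Finset.mem_erase.2 ⟨hz, hzT⟩)
    · exact hEC fun hzi => hC z ⟨(hRU (mem_ball_iff_norm.2 hzR)).1, hzi⟩
  have hgrow : E =O[Bornology.cobounded ℂ] fun z => z := by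
    obtain ⟨R, C, hC⟩ := exists_norm_im_mul_le_of_behavesSimplyAt_infty hs.2
    obtain ⟨R', hR'⟩ := T.finite_toSet.isBounded.exists_norm_le
    refine isBigO_cobounded_of_norm_im_mul_le (R := max R R') (C := |C|) (fun z hz => hEd z fun h => ?_)
      (fun z hz => ?_)
    · exact absurd (hR' z h) (not_le.2 ((le_max_right _ _).trans_lt hz))
    · have h1 := hEC (z := z) fun hzi => hC z hzi ((le_max_left _ _).trans_lt hz)
      rwa [abs_mul, abs_of_nonneg (sq_nonneg ‖z‖)] at h1
  obtain ⟨ρ, h, hh, hEh⟩ := exists_eq_add_sum_div_sub T E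
    (fun z hz => (hEd z hz).differentiableWithinAt) hpole
  have hone : (fun _ : ℂ => (1 : ℂ)) =O[Bornology.cobounded ℂ] fun z => z := by
    refine IsBigO.of_bound 1 ?_
    filter_upwards [eventually_cobounded_le_norm 1] with z hz
    simpa using hz
  have hfrac : (fun z => ∑ σ ∈ T, ρ σ / (z - σ)) =O[Bornology.cobounded ℂ] fun z => z := by
    refine IsBigO.fun_sum fun σ _ => ?_
    have h1 : Tendsto (fun z : ℂ => ρ σ * (z - σ)⁻¹) (Bornology.cobounded ℂ) (𝓝 (ρ σ * 0)) :=
      ((tendsto_inv₀_cobounded (α := ℂ)).comp (tendsto_sub_const_cobounded σ)).const_mul _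
    simp_rw [div_eq_mul_inv]
    exact (h1.isBigO_one ℂ).trans hone
  -- Both `E` and the fractions grow at most linearly, so the entire part is affine.
  have hhO : h =O[Bornology.cobounded ℂ] fun z => z := by
    refine (hgrow.sub hfrac).congr' ?_ EventuallyEq.rfl
    have : ∀ᶠ z in Bornology.cobounded ℂ, z ∉ T :=
      Bornology.isBounded_def.1 T.finite_toSet.isBounded
    filter_upwards [this] with z hz
    rw [hEh z hz, add_sub_cancel_right]
  obtain ⟨a, b, hab⟩ := exists_eq_add_mul_of_isBigO hh hhO
  refine ⟨a, b, fun σ => ρ σ, fun z hz => ?_⟩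
  have hzT : z ∉ T := fun hzT => by
    obtain ⟨s, -, rfl⟩ := Finset.mem_image.1 hzT
    exact hz (Complex.ofReal_im s)
  rw [← hEψ z hz, hEh z hzT, hab, hTdef, Finset.sum_image fun x _ y _ h => Complex.ofReal_injective h]

/-! ### Measures made of a part on `S` and finitely many atoms -/

theorem integrable_boundary_integrand {φ : ℂ → ℂ} (hφ : ContinuousOn φ imaginaryDomain)
    {f : ℝ → ℂ} (hf : Continuous f) (hfc : HasCompactSupport f) {y : ℝ} (hy : y ≠ 0) :
    Integrable fun x : ℝ => f x *
      (φ ((x : ℂ) + (y : ℂ) * Complex.I) - φ ((x : ℂ) - (y : ℂ) * Complex.I)) := by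
  have h1 : Continuous fun x : ℝ => φ ((x : ℂ) + (y : ℂ) * Complex.I) :=
    hφ.comp_continuous (by fun_prop) (add_mul_I_mem hy)
  have h2 : Continuous fun x : ℝ => φ ((x : ℂ) - (y : ℂ) * Complex.I) :=
    hφ.comp_continuous (by fun_prop) (sub_mul_I_mem hy)
  exact (hf.mul (h1.sub h2)).integrable_of_hasCompactSupport hfc.mul_right

/-- The measure on `ℝ ⊔ {∞}` induced by a measure on a set of reals. -/
noncomputable def extend {S : Set ℝ} (lamS : ComplexMeasure S) : ComplexMeasure (OnePoint ℝ) :=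
  lamS.map fun s : S => ((s : ℝ) : OnePoint ℝ)

theorem measurableEmbedding_coe_subtype {S : Set ℝ} (hS : MeasurableSet S) :
    MeasurableEmbedding fun s : S => ((s : ℝ) : OnePoint ℝ) :=
  measurableEmbedding_coe.comp (MeasurableEmbedding.subtype_coe hS)

theorem cintegral_extend {S : Set ℝ} (hS : MeasurableSet S) (lamS : ComplexMeasure S)
    (f : OnePoint ℝ → ℂ) :
    cintegral (extend lamS) f = cintegral lamS fun s => f ((s : ℝ) : OnePoint ℝ) :=
  cintegral_map lamS (measurableEmbedding_coe_subtype hS) f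

theorem extTransform_extend {S : Set ℝ} (hS : MeasurableSet S) (lamS : ComplexMeasure S) :
    extTransform (extend lamS) = transformOn S lamS := by
  ext z
  exact cintegral_extend hS lamS _

theorem extend_apply {S : Set ℝ} (hS : MeasurableSet S) (lamS : ComplexMeasure S)
    {B : Set (OnePoint ℝ)} (hB : MeasurableSet B) :
    extend lamS B = lamS ((fun s : S => ((s : ℝ) : OnePoint ℝ)) ⁻¹' B) :=
  VectorMeasure.map_apply _ (measurableEmbedding_coe_subtype hS).measurable hB

theorem extend_apply_image {S : Set ℝ} (hS : MeasurableSet S) (lamS : ComplexMeasure S)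
    {A : Set ℝ} (hA : MeasurableSet A) :
    extend lamS ((fun s : ℝ => (s : OnePoint ℝ)) '' A) = lamS (Subtype.val ⁻¹' A) := by
  rw [extend_apply hS lamS (measurableEmbedding_coe.measurableSet_image.2 hA)]
  congr 1
  ext s
  simp

/-- The difference of two functions with the same boundary values has vanishing jump. -/
theorem tendsto_jump_sub {φ : ℂ → ℂ} (hφ : DifferentiableOn ℂ φ imaginaryDomain) {S : Set ℝ}
    (hS : MeasurableSet S) {lamS : ComplexMeasure S} (h : IsBoundaryMeasure φ S lamS)
    {f : ℝ → ℂ} (hf : ContDiff ℝ ((⊤ : ℕ∞) : WithTop ℕ∞) f) (hfc : HasCompactSupport f)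
    (hfs : tsupport f ⊆ S) :
    Tendsto (fun y : ℝ => ∫ x : ℝ, f x *
      ((φ ((x : ℂ) + (y : ℂ) * Complex.I) - transformOn S lamS ((x : ℂ) + (y : ℂ) * Complex.I)) -
        (φ ((x : ℂ) - (y : ℂ) * Complex.I) - transformOn S lamS ((x : ℂ) - (y : ℂ) * Complex.I))))
      (𝓝[>] 0) (𝓝 0) := by
  set q : ℝ → ℂ := fun x => 2 * (Real.pi : ℂ) * Complex.I * (1 + (x : ℂ) ^ 2) with hq
  have hq0 : ∀ x, q x ≠ 0 := fun x => by
    have h1 : (1 + x ^ 2 : ℝ) ≠ 0 := by positivity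
    have h2 : (1 + (x : ℂ) ^ 2) ≠ 0 := by exact_mod_cast h1
    simp [hq, Real.pi_ne_zero, h2]
  have hqs : ContDiff ℝ ((⊤ : ℕ∞) : WithTop ℕ∞) q := by
    have : ContDiff ℝ ((⊤ : ℕ∞) : WithTop ℕ∞) fun x : ℝ => (x : ℂ) := Complex.ofRealCLM.contDiff
    fun_prop
  -- Testing with `f q` cancels the density `1/q` in the definition of a boundary measure.
  have h1 := h (fun x => f x * q x) (hf.mul hqs) hfc.mul_right ((tsupport_mul_subset_left).trans hfs)
  have h2 := tendsto_integral_extTransform (extend lamS) (hf.mul hqs).continuous hfc.mul_right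
  rw [cintegral_extend hS, extTransform_extend hS] at h2
  have h3 := h1.sub h2
  simp only [OnePoint.elim_some, sub_self] at h3
  refine h3.congr' ?_
  have hdS : DifferentiableOn ℂ (transformOn S lamS) imaginaryDomain := by
    rw [← extTransform_extend hS]; exact differentiableOn_extTransform _
  have e : ∀ (x : ℝ) (v : ℂ), f x * q x * (v / q x) = f x * v := fun x v => by
    have := hq0 x
    field_simp
  filter_upwards [self_mem_nhdsWithin] with y hy
  have hy0 : y ≠ 0 := ne_of_gt hy
  have e' : ∀ (x : ℝ) (v : ℂ), f x * q x *
      (v / (2 * (Real.pi : ℂ) * Complex.I * (1 + (x : ℂ) ^ 2))) = f x * v := e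
  simp only [e']
  rw [← integral_sub (integrable_boundary_integrand hφ.continuousOn hf.continuous hfc hy0)
    (integrable_boundary_integrand hdS.continuousOn hf.continuous hfc hy0)]
  congr 1
  ext x
  ring

theorem behavesSimply_sub_extTransform {φ : ℂ → ℂ} (h : BehavesSimply φ)
    (lam : ComplexMeasure (OnePoint ℝ)) : BehavesSimply fun z => φ z - extTransform lam z := by
  have h' : BehavesSimply (extTransform lam) := by
    refine behavesSimply_of_norm_le (C := 2 * lam.variation.real Set.univ) fun w hw => ?_
    have h1 := norm_im_mul_extTransform_le lam hw
    have h0 : 0 ≤ lam.variation.real Set.univ := by positivity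
    nlinarith
  have key : ∀ {φ₁ φ₂ : ℂ → ℂ} {s : ℝ}, BehavesSimplyAt φ₁ s → BehavesSimplyAt φ₂ s →
      BehavesSimplyAt (fun z => φ₁ z - φ₂ z) s := by
    rintro φ₁ φ₂ s ⟨U, hU, C, hC⟩ ⟨V, hV, D, hD⟩
    refine ⟨U ∩ V, inter_mem hU hV, C + D, fun z hz => ?_⟩
    rw [mul_sub]
    exact (norm_sub_le _ _).trans (add_le_add (hC z ⟨hz.1.1, hz.2⟩) (hD z ⟨hz.1.2, hz.2⟩))
  exact ⟨fun s => key (h.1 s) (h'.1 s), key h.2 h'.2⟩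

/-- The measure which coincides with `λ_S` on `S` and has the atoms `c p` at the points `p` of
`(ℝ ∖ S) ⊔ {∞}`. -/
noncomputable def extendWithAtoms {S : Set ℝ} (hT : Sᶜ.Finite) (lamS : ComplexMeasure S)
    (c : OnePoint ℝ → ℂ) : ComplexMeasure (OnePoint ℝ) :=
  extend lamS + (VectorMeasure.dirac ∞ (c ∞) +
    ∑ σ ∈ hT.toFinset, VectorMeasure.dirac (σ : OnePoint ℝ) (c σ))

theorem extTransform_extendWithAtoms {S : Set ℝ} (hS : MeasurableSet S) (hT : Sᶜ.Finite)
    (lamS : ComplexMeasure S) (c : OnePoint ℝ → ℂ) {z : ℂ} (hz : z ∈ imaginaryDomain) :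
    extTransform (extendWithAtoms hT lamS c) z =
      transformOn S lamS z + (z * c ∞ + ∑ σ ∈ hT.toFinset, kernel z σ * c σ) := by
  have hi : ∀ μ : ComplexMeasure (OnePoint ℝ), μ.Integrable (extKernel z) := fun μ =>
    integrable_of_continuous μ (continuous_extKernel hz)
  rw [← extTransform_extend hS]
  simp only [extTransform, extendWithAtoms]
  rw [cintegral_add_measure (hi _) (hi _), cintegral_add_measure (hi _) (hi _),
    cintegral_sum_measure _ fun σ _ => hi _]
  simp only [cintegral_dirac, extKernel_infty, extKernel_coe]

/-- The complement of `S` in the extended line is finite, so a measure is fixed by its values inside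
`S` and its point masses there. -/
theorem eq_extendWithAtoms {S : Set ℝ} (hS : MeasurableSet S) (hT : Sᶜ.Finite)
    {lamS : ComplexMeasure S} {lam : ComplexMeasure (OnePoint ℝ)}
    (h : ∀ A : Set ℝ, MeasurableSet A → A ⊆ S →
      lam ((fun s : ℝ => (s : OnePoint ℝ)) '' A) = lamS (Subtype.val ⁻¹' A)) :
    lam = extendWithAtoms hT lamS fun p => lam {p} := by
  classical
  have hdirac : ∀ (p : OnePoint ℝ) (B : Set (OnePoint ℝ)), MeasurableSet B →
      VectorMeasure.dirac p (lam {p}) B = lam ({p} ∩ B) := by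
    intro p B hB
    by_cases hp : p ∈ B
    · rw [VectorMeasure.dirac_apply_of_mem hB hp, Set.singleton_inter_of_mem hp]
    · rw [VectorMeasure.dirac_apply_of_notMem hp, Set.singleton_inter_eq_empty.2 hp,
        VectorMeasure.empty]
  ext B hB
  set A : Set ℝ := S ∩ (fun s : ℝ => (s : OnePoint ℝ)) ⁻¹' B with hA
  have hAm : MeasurableSet A := hS.inter (measurableEmbedding_coe.measurable hB)
  set F : Finset (OnePoint ℝ) := insert ∞ (hT.toFinset.image fun s : ℝ => (s : OnePoint ℝ)) with hF
  have hFm : MeasurableSet (⋃ p ∈ F, {p} ∩ B) :=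
    F.measurableSet_biUnion fun p _ => (measurableSet_singleton p).inter hB
  have hsplit : B = (fun s : ℝ => (s : OnePoint ℝ)) '' A ∪ ⋃ p ∈ F, {p} ∩ B := by
    ext p
    induction p using OnePoint.rec with
    | infty => simp [hF]
    | coe s =>
      by_cases hs : s ∈ S <;> simp [hF, hA, hs]
  have hdisj : Disjoint ((fun s : ℝ => (s : OnePoint ℝ)) '' A) (⋃ p ∈ F, {p} ∩ B) := by
    rw [Set.disjoint_left]
    rintro _ ⟨s, hs, rfl⟩ h2
    simp [hF, hs.1] at h2
  have h1 : lam B = lam ((fun s : ℝ => (s : OnePoint ℝ)) '' A) + ∑ p ∈ F, lam ({p} ∩ B) := by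
    conv_lhs => rw [hsplit]
    rw [VectorMeasure.of_union hdisj (measurableEmbedding_coe.measurableSet_image.2 hAm) hFm]
    congr 1
    refine VectorMeasure.of_biUnion_finset (fun p _ q _ hpq => ?_)
      fun p _ => (measurableSet_singleton p).inter hB
    exact (Set.disjoint_singleton.2 hpq).mono Set.inter_subset_left Set.inter_subset_left
  have h2 : extend lamS B = lamS (Subtype.val ⁻¹' A) := by
    rw [extend_apply hS lamS hB]
    congr 1
    ext s
    simp [hA]
  have h3 : (∑ σ ∈ hT.toFinset, VectorMeasure.dirac (σ : OnePoint ℝ) (lam {(σ : OnePoint ℝ)})) B =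
      ∑ σ ∈ hT.toFinset, lam ({(σ : OnePoint ℝ)} ∩ B) := by
    rw [sum_apply]
    exact Finset.sum_congr rfl fun σ _ => hdirac _ B hB
  rw [h1, h A hAm Set.inter_subset_left, extendWithAtoms, add_apply,
    add_apply, h2, h3, hdirac _ B hB, hF, Finset.sum_insert (by simp),
    Finset.sum_image fun x _ y _ hxy => OnePoint.coe_injective hxy]

/-! ### From rational functions to representing measures, and back -/

/-- Because `1 + w² = 0` at `w = ±i`, the kernel there is the constant `±i`. This forces the
additive constant in a representation to be the mean of `φ(i)` and `φ(-i)`. -/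
theorem extTransform_I_add (lam : ComplexMeasure (OnePoint ℝ)) :
    extTransform lam Complex.I + extTransform lam (-Complex.I) = 0 := by
  have hI : Complex.I ∈ imaginaryDomain := by simp [imaginaryDomain]
  have hI' : -Complex.I ∈ imaginaryDomain := by simp [imaginaryDomain]
  have h : extKernel (-Complex.I) = fun s => -1 * extKernel Complex.I s := by
    ext s
    induction s using OnePoint.rec with
    | infty => simp
    | coe s =>
      rw [extKernel_coe, extKernel_coe, kernel_eq hI, kernel_eq hI']
      simp
  rw [extTransform, extTransform, h, cintegral_const_mul]
  ring

theorem isRepresentingMeasure_of_eq_add {φ : ℂ → ℂ} {lam : ComplexMeasure (OnePoint ℝ)} {a : ℂ}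
    (h : ∀ z ∈ imaginaryDomain, φ z = a + extTransform lam z) : IsRepresentingMeasure φ lam := by
  intro w hw
  have h1 := extTransform_I_add lam
  have ha : (φ Complex.I + φ (-Complex.I)) / 2 = a := by
    rw [h Complex.I (by simp [imaginaryDomain]), h (-Complex.I) (by simp [imaginaryDomain])]
    linear_combination h1 / 2
  rw [ha]
  exact h w hw

theorem exists_isRepresentingMeasure {φ : ℂ → ℂ} (hφ : DifferentiableOn ℂ φ imaginaryDomain)
    (hs : BehavesSimply φ) {S : Set ℝ} (hS : IsOpen S) (hT : Sᶜ.Finite) {lamS : ComplexMeasure S}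
    (h : IsBoundaryMeasure φ S lamS) :
    ∃ lam : ComplexMeasure (OnePoint ℝ), IsRepresentingMeasure φ lam := by
  have hSm := hS.measurableSet
  have e := extTransform_extend hSm lamS
  obtain ⟨a, b, ρ, hψ⟩ := exists_eq_rational_of_jump_eq_zero
    (ψ := fun z => φ z - transformOn S lamS z)
    (hφ.sub (e ▸ differentiableOn_extTransform (extend lamS)))
    (e ▸ behavesSimply_sub_extTransform hs (extend lamS)) hS hT
    (fun f hf hfc hfs => tendsto_jump_sub hφ hSm h hf hfc hfs)
  -- The kernel of `σ` has residue `-(1 + σ²)` at `z = σ`, which dictates the mass. The leftover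
  -- constants `σ c σ` are absorbed into the additive constant below.
  set c : OnePoint ℝ → ℂ := fun p => p.elim b fun σ => -ρ σ / (1 + (σ : ℂ) ^ 2) with hc
  refine ⟨extendWithAtoms hT lamS c, isRepresentingMeasure_of_eq_add
    (a := a + ∑ σ ∈ hT.toFinset, (σ : ℂ) * c σ) fun z hz => ?_⟩
  have h1 : ∑ σ ∈ hT.toFinset, ρ σ / (z - σ) =
      ∑ σ ∈ hT.toFinset, (σ : ℂ) * c σ + ∑ σ ∈ hT.toFinset, kernel z σ * c σ := by
    rw [← Finset.sum_add_distrib]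
    refine Finset.sum_congr rfl fun σ _ => ?_
    have h2 := ofReal_sub_ne_zero hz σ
    have h3 : z - (σ : ℂ) ≠ 0 := by rw [← neg_sub]; exact neg_ne_zero.2 h2
    have h4 : (1 + (σ : ℂ) ^ 2) ≠ 0 := by
      have : (1 + σ ^ 2 : ℝ) ≠ 0 := by positivity
      exact_mod_cast this
    rw [kernel_eq' hz]
    simp only [hc, OnePoint.elim_some]
    field_simp
    ring
  have h2 := hψ z hz
  rw [h1] at h2
  rw [extTransform_extendWithAtoms hSm hT lamS c hz]
  have h3 : c ∞ = b := rfl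
  rw [h3]
  linear_combination h2

theorem tendsto_boundary_of_isRepresentingMeasure {φ : ℂ → ℂ} {lam : ComplexMeasure (OnePoint ℝ)}
    (h : IsRepresentingMeasure φ lam) {f : ℝ → ℂ} (hf : Continuous f) (hfc : HasCompactSupport f) :
    Tendsto (fun y : ℝ => ∫ x : ℝ, f x *
      ((φ ((x : ℂ) + (y : ℂ) * Complex.I) - φ ((x : ℂ) - (y : ℂ) * Complex.I)) /
        (2 * (Real.pi : ℂ) * Complex.I * (1 + (x : ℂ) ^ 2))))
      (𝓝[>] 0) (𝓝 (cintegral lam fun s => s.elim 0 f)) := by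
  refine (tendsto_integral_extTransform lam hf hfc).congr' ?_
  filter_upwards [self_mem_nhdsWithin] with y hy
  congr 1
  ext x
  rw [h _ (add_mul_I_mem (ne_of_gt hy) x), h _ (sub_mul_I_mem (ne_of_gt hy) x),
    add_sub_add_left_eq_sub]
  rfl

theorem IsRepresentingMeasure.exists_isBoundaryMeasure {φ : ℂ → ℂ}
    {lam : ComplexMeasure (OnePoint ℝ)} (h : IsRepresentingMeasure φ lam) :
    ∃ lamS : ComplexMeasure (Set.univ : Set ℝ), IsBoundaryMeasure φ Set.univ lamS := by
  set R : Set (OnePoint ℝ) := Set.range fun s : ℝ => (s : OnePoint ℝ) with hR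
  have hRm : MeasurableSet R := measurableEmbedding_coe.measurableSet_range
  -- The value of `g` at infinity is arbitrary: the measure is restricted to the image of `ℝ` before
  -- being pushed forward.
  set g : OnePoint ℝ → (Set.univ : Set ℝ) := fun s => ⟨s.elim 0 id, trivial⟩ with hg
  have hgm : Measurable g := (measurable_elim measurable_id).subtype_mk
  refine ⟨(lam.restrict R).map g, fun f hf hfc _ => ?_⟩
  have e : cintegral ((lam.restrict R).map g) (fun s : (Set.univ : Set ℝ) => f s) =
      cintegral lam fun s => s.elim 0 f := by
    obtain ⟨C, hC⟩ := hfc.exists_bound_of_continuous hf.continuous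
    have hfm : Measurable fun s : (Set.univ : Set ℝ) => f s :=
      hf.continuous.measurable.comp measurable_subtype_coe
    rw [cintegral, VectorMeasure.integral_map hgm hfm.aestronglyMeasurable
      (integrable_of_measurable_of_norm_le _ (hfm.comp hgm) fun s => hC _),
      ← VectorMeasure.integral_indicator hRm, cintegral]
    congr 1
    ext s
    induction s using OnePoint.rec with
    | infty => simp [hR]
    | coe s => simp [hR, hg]
  rw [e]
  exact tendsto_boundary_of_isRepresentingMeasure h hf.continuous hfc

/-- Stieltjes inversion and the boundary measure compute the same limit, so the two measures have
equal test integrals on `S`. -/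
theorem IsRepresentingMeasure.eq_on {φ : ℂ → ℂ} {lam : ComplexMeasure (OnePoint ℝ)}
    (h : IsRepresentingMeasure φ lam) {S : Set ℝ} (hS : IsOpen S) {lamS : ComplexMeasure S}
    (hb : IsBoundaryMeasure φ S lamS) {A : Set ℝ} (hA : MeasurableSet A) (hAS : A ⊆ S) :
    lam ((fun s : ℝ => (s : OnePoint ℝ)) '' A) = lamS (Subtype.val ⁻¹' A) := by
  rw [← extend_apply_image hS.measurableSet lamS hA]
  refine eq_on_of_cintegral_eq hS (fun f hf hfc hfs => ?_) hA hAS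
  rw [cintegral_extend hS.measurableSet]
  exact tendsto_nhds_unique (tendsto_boundary_of_isRepresentingMeasure h hf.continuous hfc)
    (hb f hf hfc hfs)

theorem analyticAt_kernel {z : ℂ} {s : ℝ} (h : z ≠ s) : AnalyticAt ℂ (fun z => kernel z s) z := by
  unfold kernel
  exact AnalyticAt.div (by fun_prop) (by fun_prop) (sub_ne_zero.2 h.symm)

end BoundaryMeasure

/-! ### The main theorem -/

theorem mainTheorem1 (φ : ℂ → ℂ) (hφ : DifferentiableOn ℂ φ BoundaryMeasure.imaginaryDomain) :
    ((∃ lam : ComplexMeasure (OnePoint ℝ), BoundaryMeasure.IsRepresentingMeasure φ lam) ↔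
      (BoundaryMeasure.BehavesSimply φ ∧
        ∃ S : Set ℝ, IsOpen S ∧ Sᶜ.Finite ∧
          ∃ lamS : ComplexMeasure S, BoundaryMeasure.IsBoundaryMeasure φ S lamS)) ∧
    (∀ lam : ComplexMeasure (OnePoint ℝ), BoundaryMeasure.IsRepresentingMeasure φ lam →
      ∀ S : Set ℝ, IsOpen S → Sᶜ.Finite →
      ∀ lamS : ComplexMeasure S, BoundaryMeasure.IsBoundaryMeasure φ S lamS →
        -- `ψ` is the holomorphic extension of `φ - φ_S` and `ρ` is its residue on `Σ`
        ∃ (ψ : ℂ → ℂ) (ρ : OnePoint ℝ → ℂ),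
          DifferentiableOn ℂ ψ (BoundaryMeasure.imaginaryDomain ∪ (fun s : ℝ => (s : ℂ)) '' S) ∧
          (∀ z ∈ BoundaryMeasure.imaginaryDomain,
            ψ z = φ z - BoundaryMeasure.transformOn S lamS z) ∧
          (∀ σ : ℝ, σ ∉ S →
            BoundaryMeasure.HasAtMostSimplePoleWithResidue ψ (σ : ℂ) (ρ (σ : OnePoint ℝ))) ∧
          BoundaryMeasure.HasAtMostSimplePoleWithResidue (fun z => ψ (1 / z)) 0 (ρ ∞) ∧
          (∀ A : Set ℝ, MeasurableSet A → A ⊆ S →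
            lam ((fun s : ℝ => (s : OnePoint ℝ)) '' A) = lamS (Subtype.val ⁻¹' A)) ∧
          (∀ σ : ℝ, σ ∉ S →
            lam {(σ : OnePoint ℝ)} = -ρ (σ : OnePoint ℝ) / (1 + (σ : ℂ) ^ 2)) ∧
          lam {∞} = ρ ∞) := by
  classical
  refine ⟨⟨fun ⟨lam, h⟩ => ⟨h.behavesSimply, Set.univ, isOpen_univ, by simp,
    h.exists_isBoundaryMeasure⟩, fun ⟨hs, S, hS, hT, lamS, hb⟩ =>
    BoundaryMeasure.exists_isRepresentingMeasure hφ hs hS hT hb⟩, fun lam h S hS hT lamS hb => ?_⟩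
  have heq := fun A (hA : MeasurableSet A) hAS => h.eq_on hS hb (A := A) hA hAS
  have hlam := BoundaryMeasure.eq_extendWithAtoms hS.measurableSet hT heq
  set a := (φ Complex.I + φ (-Complex.I)) / 2 with ha
  have hsq : ∀ σ : ℝ, (1 + (σ : ℂ) ^ 2) ≠ 0 := fun σ => by
    have : (1 + σ ^ 2 : ℝ) ≠ 0 := by positivity
    exact_mod_cast this
  -- As `lam` consists of `lamS` and atoms, `φ - φ_S` is literally this rational function; the
  -- residues are read off from the kernels.
  refine ⟨fun z => a + (z * lam {∞} + ∑ σ ∈ hT.toFinset,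
      BoundaryMeasure.kernel z σ * lam {(σ : OnePoint ℝ)}),
    fun p => p.elim (lam {∞}) fun σ => -(1 + (σ : ℂ) ^ 2) * lam {(σ : OnePoint ℝ)},
    ?_, fun z hz => ?_, fun σ hσ => ?_, ?_, heq, fun σ hσ => ?_, rfl⟩
  · intro z hz
    have hzσ : ∀ σ ∈ hT.toFinset, z ≠ (σ : ℂ) := by
      rintro σ hσ rfl
      rcases hz with hz | ⟨s, hs, hsσ⟩
      · exact hz (Complex.ofReal_im σ)
      · exact (hT.mem_toFinset.1 hσ) (Complex.ofReal_injective hsσ ▸ hs)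
    refine DifferentiableAt.differentiableWithinAt ?_
    refine (differentiableAt_const a).add ((differentiableAt_id.mul_const _).add ?_)
    exact DifferentiableAt.fun_sum fun σ hσ =>
      (BoundaryMeasure.analyticAt_kernel (hzσ σ hσ)).differentiableAt.mul_const _
  · have h1 := BoundaryMeasure.extTransform_extendWithAtoms hS.measurableSet hT lamS
      (fun p => lam {p}) hz
    rw [← hlam] at h1
    have h2 := h z hz
    rw [← ha] at h2
    change φ z = a + BoundaryMeasure.extTransform lam z at h2
    rw [h2, h1]
    ring
  · refine ⟨fun z => a + (z * lam {∞} + (-(σ : ℂ) * lam {(σ : OnePoint ℝ)} +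
      ∑ τ ∈ hT.toFinset.erase σ, BoundaryMeasure.kernel z τ * lam {(τ : OnePoint ℝ)})), ?_, ?_⟩
    · refine analyticAt_const.add ((analyticAt_id.mul analyticAt_const).add
        (analyticAt_const.add (Finset.analyticAt_fun_sum _ fun τ hτ => ?_)))
      refine (BoundaryMeasure.analyticAt_kernel ?_).mul analyticAt_const
      exact fun hστ => (Finset.mem_erase.1 hτ).1 (Complex.ofReal_injective hστ.symm)
    · filter_upwards [self_mem_nhdsWithin] with z hz
      have hz1 : z - (σ : ℂ) ≠ 0 := sub_ne_zero.2 hz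
      have hz2 : (σ : ℂ) - z ≠ 0 := sub_ne_zero.2 (Ne.symm hz)
      rw [← Finset.add_sum_erase _ _ (hT.mem_toFinset.2 hσ)]
      have e : BoundaryMeasure.kernel z σ * lam {(σ : OnePoint ℝ)} -
          -(1 + (σ : ℂ) ^ 2) * lam {(σ : OnePoint ℝ)} / (z - σ) =
          -(σ : ℂ) * lam {(σ : OnePoint ℝ)} := by
        rw [BoundaryMeasure.kernel]
        field_simp
        ring
      simp only [OnePoint.elim_some]
      linear_combination e
  -- The kernel of `τ` at `1/z` equals `(z + τ)/(τz - 1)`, whose denominator is `-1` at `z = 0`.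
  -- Only the term `lam {∞} / z` is singular.
  · refine ⟨fun z => a + ∑ τ ∈ hT.toFinset, (z + τ) / (τ * z - 1) * lam {(τ : OnePoint ℝ)}, ?_, ?_⟩
    · refine analyticAt_const.add (Finset.analyticAt_fun_sum _ fun τ hτ => ?_)
      refine AnalyticAt.mul (AnalyticAt.div (by fun_prop) (by fun_prop) ?_) analyticAt_const
      simp
    · filter_upwards [self_mem_nhdsWithin] with z hz
      have hz0 : z ≠ 0 := hz
      have e : ∀ τ : ℝ, BoundaryMeasure.kernel (1 / z) τ = (z + τ) / (τ * z - 1) := fun τ => by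
        rw [BoundaryMeasure.kernel, ← mul_div_mul_left _ _ hz0]
        congr 1 <;> field_simp
      simp only [e, OnePoint.elim_infty, sub_zero]
      ring
  · have := hsq σ
    simp only [OnePoint.elim_some]
    field_simp
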